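/- Let $\mathcal W$ be an arbitrary set of (mixed) quantum states on qubit registers, and let $\beta<\alpha$ be real numbers. All quantum circuits are over the universal, inverse-closed gate set $\{X, H, T, T^{-1}, \mathrm{CNOT}, \mathrm{Toffoli}\}$ and are described by bit strings in which all numbers are written in unary. **The class $\mathrm{QMA}_{\mathcal W}^{c,s}$.** For $c,s:\mathbb N\to\mathbb R$, a promise problem $A=(A_{yes},A_{no})$ over $\{0,1\}^*$ (with $A_{yes}\cap A_{no}=\emptyset$) is in $\mathrm{QMA}_{\mathcal W}^{c,s}$ if there is a polynomial-time computable function that maps every $x\in A_{yes}\cup A_{no}$ to the description of a verification circuit $Q_x$, with a proof register of $p_x$ qubits, an input register of $|x|$ qubits and a scratch register of $q_x$ qubits (at least one qubit in total), such that, where $Q_x$ accepts if measuring a designated qubit (the last one) of its output in the computational basis gives $1$: * (completeness) if $x\in A_{yes}$, there is a $p_x$-qubit state $\rho\in\mathcal W$ such that $Q_x$ accepts $\rho\otimes|x\rangle\langle x|\otimes|0\rangle\langle 0|^{\otimes q_x}$ with probability at least $c(|x|)$; * (soundness) if $x\in A_{no}$, then for every $p_x$-qubit state $\rho\in\mathcal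 W$, $Q_x$ accepts $\rho\otimes|x\rangle\langle x|\otimes|0\rangle\langle 0|^{\otimes q_x}$ with probability at most $s(|x|)$. **The problem $(\alpha,\beta)$ Padded-$\mathcal W$ Isometry Output.** The input is the description of $n,m_1,m_2\in\mathbb N$ with $n\le m_1+m_2$ and of a quantum circuit $C$ on $m_1+m_2$ qubits; it implements the isometry $U(\rho)=C\,(\rho\otimes|0\rangle\langle0|^{\otimes(m_1+m_2-n)})\,C^\dagger$ from $n$ qubits to $m_1+m_2$ qubits. Let $F(\rho,\sigma)=\big(\mathrm{Tr}\sqrt{\sqrt\rho\,\sigma\sqrt\rho}\big)^2$. * YES: there are an $n$-qubit state $\rho$ and an $m_1$-qubit state $\sigma\in\mathcal W$ with $F(U(\rho),\sigma\otimes|0\rangle\langle0|^{\otimes m_2})\ge\alpha$. * NO: for every $n$-qubit state $\rho$ and every $m_1$-qubit state $\sigma\in\mathcal W$, $F(U(\rho),\sigma\otimes|0\rangle\langle0|^{\otimes m_2})\le\beta$. **Theorem.** The $(\alpha,\beta)$ Padded-$\mathcal W$ Isometry Output problem is complete for $\mathrm{QMA}_{\mathcal W}^{\alpha,\beta}$ (with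 constant functions $c=\alpha$, $s=\beta$): it belongs to this class, and every promise problem in the class reduces to it by a polynomial-time many-one reduction. -/

import Mathlib

open scoped MatrixOrder ComplexOrder

namespace QuantumProofs

noncomputable section

/-! ### States of qubit registers -/

/-- Square complex matrices indexed by the computational basis of an `N`-qubit register. The basis
states are the bit strings `Fin N → Bool`, with `false` for `|0⟩` and `true` for `|1⟩`. -/
abbrev QMatrix (N : ℕ) : Type := Matrix (Fin N → Bool) (Fin N → Bool) ℂ

/-- An `N`-qubit (mixed) quantum state, given by its density matrix. -/
structure QState (N : ℕ) where
  mat : QMatrix N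
  posSemidef : mat.PosSemidef
  trace_eq_one : mat.trace = 1

/-- For an operator `ρ` on the first `n` of `N` qubits and a string `z` of `N` bits, the operator
`ρ ⊗ |z_n ⋯ z_{N-1}⟩⟨z_n ⋯ z_{N-1}|` on `N` qubits. -/
def attachBits {n N : ℕ} (h : n ≤ N) (ρ : QMatrix n) (z : Fin N → Bool) : QMatrix N :=
  fun i j =>
    if ∀ k : Fin N, n ≤ k.val → i k = z k ∧ j k = z k then
      ρ (fun k => i (Fin.castLE h k)) (fun k => j (Fin.castLE h k))
    else 0

/-- The operator `ρ ⊗ |0 ⋯ 0⟩⟨0 ⋯ 0|` on `N` qubits. -/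
def attachZeros {n N : ℕ} (h : n ≤ N) (ρ : QMatrix n) : QMatrix N :=
  attachBits h ρ (fun _ => false)

/-- The squared fidelity `F(ρ, σ) = (Tr √(√ρ σ √ρ))²`. -/
def fidelity {N : ℕ} (ρ σ : QMatrix N) : ℝ :=
  (Matrix.trace (CFC.sqrt (CFC.sqrt ρ * σ * CFC.sqrt ρ))).re ^ 2

/-! ### Quantum circuits -/

/-- The gates of a circuit on `N` qubits, with the wires they act on: Pauli `X`, Hadamard, the
`T` gate and its inverse, the controlled NOT gate and the Toffoli gate. For the last two the target
is the last wire. This is a universal gate set that is closed under inverses. -/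
inductive Gate (N : ℕ) : Type
  | X (t : Fin N)
  | H (t : Fin N)
  | T (t : Fin N)
  | Tinv (t : Fin N)
  | CNOT (a t : Fin N) (hat : a ≠ t)
  | Toffoli (a b t : Fin N) (hab : a ≠ b) (hat : a ≠ t) (hbt : b ≠ t)

/-- The Pauli `X` matrix. -/
def pauliX : Matrix Bool Bool ℂ := fun a b => if a = b then 0 else 1

/-- The Hadamard matrix. -/
def hadamard : Matrix Bool Bool ℂ :=
  fun a b => (if a = true ∧ b = true then -1 else 1) / (Real.sqrt 2 : ℂ)

/-- The diagonal matrix with entries `1` and `exp (i θ)`. -/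
def phase (θ : ℝ) : Matrix Bool Bool ℂ :=
  Matrix.diagonal fun a => if a = true then Complex.exp (Complex.I * θ) else 1

/-- The operator on `N` qubits that applies the one-qubit operator `u` to qubit `t` when all qubits
in `controls` (a set not containing `t`) are `1`, and the identity otherwise. -/
def controlled {N : ℕ} (controls : Finset (Fin N)) (t : Fin N) (u : Matrix Bool Bool ℂ) :
    QMatrix N :=
  fun i j =>
    if ∀ k, k ≠ t → i k = j k then
      (if ∀ k ∈ controls, j k = true then u (i t) (j t) else if i t = j t then 1 else 0)
    else 0

/-- The unitary matrix of a gate, acting on the whole register. -/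
def Gate.matrix {N : ℕ} : Gate N → QMatrix N
  | .X t => controlled ∅ t pauliX
  | .H t => controlled ∅ t hadamard
  | .T t => controlled ∅ t (phase (Real.pi / 4))
  | .Tinv t => controlled ∅ t (phase (-(Real.pi / 4)))
  | .CNOT a t _ => controlled {a} t pauliX
  | .Toffoli a b t _ _ _ => controlled {a, b} t pauliX

/-- The unitary matrix of a circuit, i.e. of a list of gates that are applied from left to right. -/
def circuitMatrix {N : ℕ} : List (Gate N) → QMatrix N
  | [] => 1
  | g :: gs => circuitMatrix gs * g.matrix

/-! ### Descriptions of circuits as bit strings -/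

/-- The bit string `1^{a₁} 0 1^{a₂} 0 ⋯` that encodes a list of natural numbers. -/
def encodeNats (l : List ℕ) : List Bool :=
  l.flatMap fun a => List.replicate a true ++ [false]

/-- A gate as a list of numbers: its kind, then its wires. -/
def Gate.code {N : ℕ} : Gate N → List ℕ
  | .X t => [0, t.val]
  | .H t => [1, t.val]
  | .T t => [2, t.val]
  | .Tinv t => [3, t.val]
  | .CNOT a t _ => [4, a.val, t.val]
  | .Toffoli a b t _ _ _ => [5, a.val, b.val, t.val]

/-! ### Promise problems and polynomial time -/

/-- A promise problem over binary strings. -/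
structure PromiseProblem where
  yes : Set (List Bool)
  no : Set (List Bool)
  disjoint : Disjoint yes no

/-- A function on binary strings is computable in polynomial time (by a Turing machine). -/
def IsPolyTime (f : List Bool → List Bool) : Prop :=
  Nonempty (Turing.TM2ComputableInPolyTime (αΓ := Bool) (βΓ := Bool) id id f)

/-- Polynomial-time many-one (Karp) reducibility of promise problems. -/
def PolyTimeReducible (A B : PromiseProblem) : Prop :=
  ∃ f : List Bool → List Bool, IsPolyTime f ∧
    (∀ x ∈ A.yes, f x ∈ B.yes) ∧ (∀ x ∈ A.no, f x ∈ B.no)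

/-- `B` is complete for the class `𝒞`: it belongs to `𝒞`, and every problem of `𝒞` reduces to it in
polynomial time. -/
def IsCompleteFor (B : PromiseProblem) (𝒞 : Set PromiseProblem) : Prop :=
  B ∈ 𝒞 ∧ ∀ A ∈ 𝒞, PolyTimeReducible A B

/-! ### Quantum verification with proofs from a set of states -/

/-- Arthur's verification circuit on an input of length `len`. Its registers are, in this order, the
quantum proof, the input and the scratch qubits. The last qubit is measured at the end. -/
structure Verifier (len : ℕ) where
  proofQubits : ℕ
  scratchQubits : ℕ
  pos : 0 < proofQubits + (len + scratchQubits)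
  gates : List (Gate (proofQubits + (len + scratchQubits)))

/-- The description of a verification circuit as a bit string. -/
def Verifier.encode {len : ℕ} (V : Verifier len) : List Bool :=
  encodeNats (V.proofQubits :: V.scratchQubits :: V.gates.flatMap Gate.code)

/-- The state `Q (ρ ⊗ |x⟩⟨x| ⊗ |0 ⋯ 0⟩⟨0 ⋯ 0|) Q†` of all qubits after running the verification
circuit `Q` on input `x` and proof `ρ`. The bits attached to `ρ` are those of `x`, then zeros. -/
def Verifier.finalState (x : List Bool) (V : Verifier x.length) (ρ : QState V.proofQubits) :
    QMatrix (V.proofQubits + (x.length + V.scratchQubits)) :=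
  circuitMatrix V.gates *
    attachBits (Nat.le_add_right _ _) ρ.mat (fun k => x.getD (k.val - V.proofQubits) false) *
    (circuitMatrix V.gates).conjTranspose

/-- The probability that measuring the last qubit in the computational basis gives `1`. -/
def Verifier.acceptProb (x : List Bool) (V : Verifier x.length) (ρ : QState V.proofQubits) : ℝ :=
  ∑ b : Fin (V.proofQubits + (x.length + V.scratchQubits)) → Bool,
    if b ⟨V.proofQubits + (x.length + V.scratchQubits) - 1, Nat.sub_lt V.pos Nat.one_pos⟩ = true
    then (V.finalState x ρ b b).re else 0

/-- The class `QMA_𝒲^{c,s}`, where `W k` is the set of the `k`-qubit states in `𝒲`. The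
verification circuits are generated in polynomial time. Both in the completeness and in the
soundness condition the proof ranges over the states in `𝒲` on the proof register. -/
def QMA (W : (k : ℕ) → Set (QState k)) (c s : ℕ → ℝ) : Set PromiseProblem :=
  {A | ∃ f : List Bool → List Bool, IsPolyTime f ∧
    ∀ x ∈ A.yes ∪ A.no, ∃ V : Verifier x.length, f x = V.encode ∧
      (x ∈ A.yes → ∃ ρ ∈ W V.proofQubits, c x.length ≤ V.acceptProb x ρ) ∧
      (x ∈ A.no → ∀ ρ ∈ W V.proofQubits, V.acceptProb x ρ ≤ s x.length)}

/-! ### The isometry output problem -/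

/-- A circuit that implements an isometry from `n` qubits to `m₁ + m₂` qubits. -/
structure IsometryCircuit where
  n : ℕ
  m₁ : ℕ
  m₂ : ℕ
  le : n ≤ m₁ + m₂
  gates : List (Gate (m₁ + m₂))

/-- The description of an isometry circuit as a bit string. -/
def IsometryCircuit.encode (C : IsometryCircuit) : List Bool :=
  encodeNats (C.n :: C.m₁ :: C.m₂ :: C.gates.flatMap Gate.code)

/-- The output `U(ρ) = C (ρ ⊗ |0 ⋯ 0⟩⟨0 ⋯ 0|) C†` of the isometry. -/
def IsometryCircuit.output (C : IsometryCircuit) (ρ : QState C.n) : QMatrix (C.m₁ + C.m₂) :=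
  circuitMatrix C.gates * attachZeros C.le ρ.mat * (circuitMatrix C.gates).conjTranspose

/-- The squared fidelity of `U(ρ)` with `σ ⊗ |0 ⋯ 0⟩⟨0 ⋯ 0|`. -/
def IsometryCircuit.paddedFidelity (C : IsometryCircuit) (ρ : QState C.n) (σ : QState C.m₁) : ℝ :=
  fidelity (C.output ρ) (attachZeros (Nat.le_add_right C.m₁ C.m₂) σ.mat)

theorem encodeNats_cons (a : ℕ) (l : List ℕ) :
    encodeNats (a :: l) = List.replicate a true ++ false :: encodeNats l := by
  simp [encodeNats]

theorem encodeNats_injective : Function.Injective encodeNats := by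
  intro l
  induction l with
  | nil => intro l' h; cases l' <;> simp_all [encodeNats]
  | cons a l ih =>
    intro l' h
    cases l' with
    | nil => simp [encodeNats] at h
    | cons b l' =>
      rw [encodeNats_cons, encodeNats_cons] at h
      have key : a = b ∧ encodeNats l = encodeNats l' := by
        clear ih
        induction a generalizing b with
        | zero => cases b <;> simp_all [List.replicate_succ]
        | succ a iha =>
          cases b with
          | zero => simp [List.replicate_succ] at h
          | succ b =>
            simp only [List.replicate_succ, List.cons_append, List.cons.injEq, true_and] at h
            have := iha b h
            exact ⟨by rw [this.1], this.2⟩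
      rw [key.1, ih key.2]

theorem flatMap_code_injective (N : ℕ) :
    Function.Injective fun gs : List (Gate N) => gs.flatMap Gate.code := by
  intro gs
  induction gs with
  | nil =>
    intro gs' h
    cases gs' with
    | nil => rfl
    | cons g' gs' => cases g' <;> simp [Gate.code] at h
  | cons g gs ih =>
    intro gs' h
    cases gs' with
    | nil => cases g <;> simp [Gate.code] at h
    | cons g' gs' =>
      simp only [List.flatMap_cons] at h
      cases g <;> cases g' <;> simp [Gate.code, Fin.val_inj] at h <;>
        simp only [List.cons.injEq, Gate.X.injEq, Gate.H.injEq, Gate.T.injEq, Gate.Tinv.injEq,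
          Gate.CNOT.injEq, Gate.Toffoli.injEq] <;>
        first
          | exact ⟨h.1, ih h.2⟩
          | exact ⟨⟨h.1, h.2.1⟩, ih h.2.2⟩
          | exact ⟨⟨h.1, h.2.1, h.2.2.1⟩, ih h.2.2.2⟩

theorem IsometryCircuit.encode_injective : Function.Injective IsometryCircuit.encode := by
  rintro ⟨n, m₁, m₂, hle, gs⟩ ⟨n', m₁', m₂', hle', gs'⟩ h
  have h' := encodeNats_injective h
  simp only [List.cons.injEq] at h'
  obtain ⟨rfl, rfl, rfl, h4⟩ := h'
  have := flatMap_code_injective _ h4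
  subst this
  rfl

/-- The problem `(α, β)` Padded-`𝒲` Isometry Output. -/
def paddedIsometryOutput (W : (k : ℕ) → Set (QState k)) (α β : ℝ) (h : β < α) :
    PromiseProblem where
  yes := {x | ∃ C : IsometryCircuit, x = C.encode ∧
    ∃ ρ : QState C.n, ∃ σ ∈ W C.m₁, α ≤ C.paddedFidelity ρ σ}
  no := {x | ∃ C : IsometryCircuit, x = C.encode ∧
    ∀ ρ : QState C.n, ∀ σ ∈ W C.m₁, C.paddedFidelity ρ σ ≤ β}
  disjoint := by
    rw [Set.disjoint_left]
    rintro x ⟨C, rfl, ρ, σ, hσ, h1⟩ ⟨C', hC, h2⟩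
    obtain rfl := IsometryCircuit.encode_injective hC
    exact absurd (h1.trans (h2 ρ σ hσ)) (not_le.mpr h)

end

end QuantumProofs

/-!
A verification circuit and an isometry circuit are turned into each other by inversion, so that the
probability of acceptance of a proof `σ` becomes the largest fidelity of an output of the isometry
with `σ` padded by zeros.

**The largest fidelity.** Let `V` be an isometry and `S` a state. The fidelity of `V ρ Vᴴ` with `S`
is at most `Tr (Vᴴ S V)` for every state `ρ` (`fidelity_isometry_le`, a consequence of the
Cauchy–Schwarz inequality for the Hilbert–Schmidt inner product), and the bound is attained by the
normalization of `Vᴴ S V`, or by every state if `Vᴴ S V = 0` (`exists_fidelity_isometry_ge`). If `V` is a circuit `U` applied to `n`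
qubits and zeros, the bound is the probability that `Uᴴ` applied to `S` produces zeros from qubit
`n` on (`zeroProb_eq_trace`). This probability, for `S = σ ⊗ |0 ⋯ 0⟩⟨0 ⋯ 0|`, is
`IsometryCircuit.maxFidelity`.

**Membership.** Given an isometry circuit, the verifier clears the input register, which then serves
as the padding of the proof, undoes the circuit, and computes on its last qubit whether the qubits
from `n` on are `0`, by a chain of Toffoli gates on fresh scratch qubits. It accepts `σ` with
probability exactly `maxFidelity σ` (`IsometryCircuit.acceptProb_toVerifier`). Since numbers are
written in unary, the input register is long enough for the padding.

**Hardness.** Given a verification circuit `Q` for the input `x`, the isometry starts from a last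
qubit that is `0`, flips it, applies the inverse of `Q`, and adds `x` to the input register. Its
largest fidelity with `σ ⊗ |0 ⋯ 0⟩⟨0 ⋯ 0|` is the probability that `Q` accepts `σ`
(`Verifier.acceptProb_eq_maxFidelity`).

**Polynomial time.** Both translations have to be computed by Turing machines, in the form of
Mathlib's stack machines. `Fragment` is a small language for such machines, with sequential
composition, branching and loops, and with explicit bounds on the number of steps. The translations
`Program.fromVerifier` and `Program.toVerifier` are written in it, and run in quadratic time. In the
hardness part, the machine that generates the verification circuits is run first; as a machine
pushes a bounded number of symbols in each step, its output has polynomial length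
(`IsPolyTime.comp_program`).
-/

namespace QuantumProofs
open Turing Function

/-! ### Fragments of stack machines -/

section Fragments

variable {K : Type} {Γ : K → Type} {σ : Type}

/-- A fragment of a stack machine: a finite set of labels with a statement for each. The label
`none` stands for the exit of the fragment, which is left open. -/
structure Fragment (K : Type) (Γ : K → Type) (σ : Type) where
  Λ : Type
  [fin : Fintype Λ]
  entry : Λ
  code : Λ → TM2.Stmt Γ (Option Λ) σ

attribute [instance] Fragment.fin

/-- Renames the labels of a statement. -/
def relabel {L L' : Type} (g : L → L') : TM2.Stmt Γ L σ → TM2.Stmt Γ L' σ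
  | .push k f q => .push k f (relabel g q)
  | .peek k f q => .peek k f (relabel g q)
  | .pop k f q => .pop k f (relabel g q)
  | .load f q => .load f (relabel g q)
  | .branch p q₁ q₂ => .branch p (relabel g q₁) (relabel g q₂)
  | .goto f => .goto fun v => g (f v)
  | .halt => .halt

/-- Replaces halting by a jump to the exit. -/
def exitOnHalt {L : Type} : TM2.Stmt Γ L σ → TM2.Stmt Γ (Option L) σ
  | .push k f q => .push k f (exitOnHalt q)
  | .peek k f q => .peek k f (exitOnHalt q)
  | .pop k f q => .pop k f (exitOnHalt q)
  | .load f q => .load f (exitOnHalt q)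
  | .branch p q₁ q₂ => .branch p (exitOnHalt q₁) (exitOnHalt q₂)
  | .goto f => .goto fun v => some (f v)
  | .halt => .goto fun _ => none

variable [DecidableEq K]

theorem stepAux_relabel {L L' : Type} (g : L → L') (q : TM2.Stmt Γ L σ) (v : σ)
    (S : ∀ k, List (Γ k)) :
    TM2.stepAux (relabel g q) v S =
      ⟨(TM2.stepAux q v S).l.map g, (TM2.stepAux q v S).var, (TM2.stepAux q v S).stk⟩ := by
  induction q generalizing v S with
  | branch p q₁ q₂ h₁ h₂ => cases h : p v <;> simp [relabel, h, h₁, h₂]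
  | _ => simp_all [relabel]

theorem stepAux_exitOnHalt {L : Type} (q : TM2.Stmt Γ L σ) (v : σ) (S : ∀ k, List (Γ k)) :
    TM2.stepAux (exitOnHalt q) v S =
      ⟨some (TM2.stepAux q v S).l, (TM2.stepAux q v S).var, (TM2.stepAux q v S).stk⟩ := by
  induction q generalizing v S with
  | branch p q₁ q₂ h₁ h₂ => cases h : p v <;> simp [exitOnHalt, h, h₁, h₂]
  | _ => simp_all [exitOnHalt]

namespace Fragment

/-- `P.Reach l v S n v' S'`: started at label `l` with internal state `v` and stacks `S`, the
fragment `P` arrives at its exit after `n` steps, with internal state `v'` and stacks `S'`. -/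
inductive Reach (P : Fragment K Γ σ) :
    P.Λ → σ → (∀ k, List (Γ k)) → ℕ → σ → (∀ k, List (Γ k)) → Prop
  | exit {l v S v' S'} (h : TM2.stepAux (P.code l) v S = ⟨some none, v', S'⟩) :
      Reach P l v S 1 v' S'
  | step {l v S l₁ v₁ S₁ n v' S'} (h : TM2.stepAux (P.code l) v S = ⟨some (some l₁), v₁, S₁⟩)
      (hr : Reach P l₁ v₁ S₁ n v' S') : Reach P l v S (n + 1) v' S'

/-- The fragment leads from its entry to its exit in at most `t` steps, and transforms the internal
state and the stacks as indicated. -/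
def Run (P : Fragment K Γ σ) (v : σ) (S : ∀ k, List (Γ k)) (v' : σ) (S' : ∀ k, List (Γ k))
    (t : ℕ) : Prop :=
  ∃ n ≤ t, P.Reach P.entry v S n v' S'

theorem Run.mono {P : Fragment K Γ σ} {v v' : σ} {S S' : ∀ k, List (Γ k)} {t t' : ℕ}
    (h : P.Run v S v' S' t) (ht : t ≤ t') : P.Run v S v' S' t' := by
  obtain ⟨n, hn, hr⟩ := h
  exact ⟨n, hn.trans ht, hr⟩

theorem Run.of_eq {P : Fragment K Γ σ} {v v' w : σ} {S S' T : ∀ k, List (Γ k)} {t t' : ℕ}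
    (h : P.Run v S v' S' t) (hv : v' = w) (hS : S' = T) (ht : t ≤ t') : P.Run v S w T t' := by
  subst hv hS
  exact h.mono ht

/-- A single statement. -/
def single (q : TM2.Stmt Γ (Option Unit) σ) : Fragment K Γ σ where
  Λ := Unit
  entry := ()
  code _ := q

theorem run_single {q : TM2.Stmt Γ (Option Unit) σ} {v v' : σ} {S S' : ∀ k, List (Γ k)}
    (h : TM2.stepAux q v S = ⟨some none, v', S'⟩) : (single q).Run v S v' S' 1 :=
  ⟨1, le_rfl, .exit h⟩

/-- Sequential composition, with notation `P ⨟ Q`. -/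
def seq (P Q : Fragment K Γ σ) : Fragment K Γ σ where
  Λ := P.Λ ⊕ Q.Λ
  entry := .inl P.entry
  code
    | .inl l => relabel (fun o => some (o.elim (.inr Q.entry) .inl)) (P.code l)
    | .inr l => relabel (Option.map .inr) (Q.code l)

infixr:60 " ⨟ " => seq

theorem run_seq {P Q : Fragment K Γ σ} {v₁ v₂ v₃ : σ} {S₁ S₂ S₃ : ∀ k, List (Γ k)} {t₁ t₂ : ℕ}
    (hP : P.Run v₁ S₁ v₂ S₂ t₁) (hQ : Q.Run v₂ S₂ v₃ S₃ t₂) :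
    (P ⨟ Q).Run v₁ S₁ v₃ S₃ (t₁ + t₂) := by
  obtain ⟨n₁, hn₁, h₁⟩ := hP
  obtain ⟨n₂, hn₂, h₂⟩ := hQ
  refine ⟨n₁ + n₂, by omega, ?_⟩
  have hQ' : ∀ {l v S n v' S'}, Q.Reach l v S n v' S' →
      (P ⨟ Q).Reach (.inr l) v S n v' S' := by
    intro l v S n v' S' h
    induction h with
    | exit h => exact .exit (by simp [seq, stepAux_relabel, h])
    | step h _ ih => exact .step (by simp [seq, stepAux_relabel, h]) ih
  change (P ⨟ Q).Reach (.inl P.entry) _ _ _ _ _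
  generalize P.entry = l at h₁
  induction h₁ with
  | exit h => rw [add_comm]; exact .step (by simp [seq, stepAux_relabel, h]) (hQ' h₂)
  | @step l v S l₁ v₁ S₁ n v' S' h _ ih =>
    rw [add_right_comm]
    exact .step (by simp [seq, stepAux_relabel, h]) (ih (by omega) h₂)

theorem Reach.pos {P : Fragment K Γ σ} {l : P.Λ} {v v' : σ} {S S' : ∀ k, List (Γ k)} {n : ℕ}
    (h : P.Reach l v S n v' S') : 0 < n := by
  cases h <;> omega

/-- A form of `run_seq` for a given time bound. Because every fragment takes at least one step, the
truncated subtraction does no harm. -/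
theorem run_seq_sub {P Q : Fragment K Γ σ} {v₁ v₂ v₃ : σ} {S₁ S₂ S₃ : ∀ k, List (Γ k)} {t₁ t : ℕ}
    (hP : P.Run v₁ S₁ v₂ S₂ t₁) (hQ : Q.Run v₂ S₂ v₃ S₃ (t - t₁)) :
    (P ⨟ Q).Run v₁ S₁ v₃ S₃ t := by
  obtain ⟨n, hn, hr⟩ := id hQ
  have := hr.pos
  exact (run_seq hP hQ).mono (by omega)

/-- Performs the test `q`, then continues with `P` or `Q` if it leads to `true` or `false`. -/
def cond (q : TM2.Stmt Γ Bool σ) (P Q : Fragment K Γ σ) : Fragment K Γ σ where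
  Λ := Option (P.Λ ⊕ Q.Λ)
  entry := none
  code
    | none => relabel (fun b => some (some (if b then .inl P.entry else .inr Q.entry))) q
    | some (.inl l) => relabel (Option.map (some ∘ .inl)) (P.code l)
    | some (.inr l) => relabel (Option.map (some ∘ .inr)) (Q.code l)

theorem run_cond_true {q : TM2.Stmt Γ Bool σ} {P Q : Fragment K Γ σ} {v₁ v₂ v₃ : σ}
    {S₁ S₂ S₃ : ∀ k, List (Γ k)} {t : ℕ} (h : TM2.stepAux q v₁ S₁ = ⟨some true, v₂, S₂⟩)
    (hP : P.Run v₂ S₂ v₃ S₃ t) : (cond q P Q).Run v₁ S₁ v₃ S₃ (t + 1) := by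
  obtain ⟨n, hn, hr⟩ := hP
  have key : ∀ {l v S n v' S'}, P.Reach l v S n v' S' →
      (cond q P Q).Reach (some (.inl l)) v S n v' S' := by
    intro l v S n v' S' h
    induction h with
    | exit h => exact .exit (by simp [cond, stepAux_relabel, h])
    | step h _ ih => exact .step (by simp [cond, stepAux_relabel, h]) ih
  exact ⟨n + 1, by omega, .step (l₁ := some (.inl P.entry)) (v₁ := v₂) (S₁ := S₂)
    (by simp [cond, stepAux_relabel, h]) (key hr)⟩

theorem run_cond_false {q : TM2.Stmt Γ Bool σ} {P Q : Fragment K Γ σ} {v₁ v₂ v₃ : σ}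
    {S₁ S₂ S₃ : ∀ k, List (Γ k)} {t : ℕ} (h : TM2.stepAux q v₁ S₁ = ⟨some false, v₂, S₂⟩)
    (hQ : Q.Run v₂ S₂ v₃ S₃ t) : (cond q P Q).Run v₁ S₁ v₃ S₃ (t + 1) := by
  obtain ⟨n, hn, hr⟩ := hQ
  have key : ∀ {l v S n v' S'}, Q.Reach l v S n v' S' →
      (cond q P Q).Reach (some (.inr l)) v S n v' S' := by
    intro l v S n v' S' h
    induction h with
    | exit h => exact .exit (by simp [cond, stepAux_relabel, h])
    | step h _ ih => exact .step (by simp [cond, stepAux_relabel, h]) ih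
  exact ⟨n + 1, by omega, .step (l₁ := some (.inr Q.entry)) (v₁ := v₂) (S₁ := S₂)
    (by simp [cond, stepAux_relabel, h]) (key hr)⟩

/-- Repeats the test `q` followed by the body `P` until the test leads to `false`. -/
def loop (q : TM2.Stmt Γ Bool σ) (P : Fragment K Γ σ) : Fragment K Γ σ where
  Λ := Option P.Λ
  entry := none
  code
    | none => relabel (fun b => if b then some (some P.entry) else none) q
    | some l => relabel some (P.code l)

theorem run_loop_exit {q : TM2.Stmt Γ Bool σ} {P : Fragment K Γ σ} {v v' : σ}
    {S S' : ∀ k, List (Γ k)} (h : TM2.stepAux q v S = ⟨some false, v', S'⟩) :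
    (loop q P).Run v S v' S' 1 :=
  ⟨1, le_rfl, .exit (by simp [loop, stepAux_relabel, h])⟩

theorem run_loop_step {q : TM2.Stmt Γ Bool σ} {P : Fragment K Γ σ} {v₁ v₂ v₃ v₄ : σ}
    {S₁ S₂ S₃ S₄ : ∀ k, List (Γ k)} {t t' : ℕ}
    (h : TM2.stepAux q v₁ S₁ = ⟨some true, v₂, S₂⟩) (hP : P.Run v₂ S₂ v₃ S₃ t)
    (hl : (loop q P).Run v₃ S₃ v₄ S₄ t') : (loop q P).Run v₁ S₁ v₄ S₄ (1 + t + t') := by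
  obtain ⟨n, hn, hr⟩ := hP
  obtain ⟨n', hn', hr'⟩ := hl
  refine ⟨n + n' + 1, by omega, .step (l₁ := some P.entry) (v₁ := v₂) (S₁ := S₂)
    (by simp [loop, stepAux_relabel, h]) ?_⟩
  clear h hn
  generalize P.entry = l at hr
  induction hr with
  | exit h => rw [add_comm]; exact .step (l₁ := none) (by simp [loop, stepAux_relabel, h]) hr'
  | @step l v S l₁ v₁ S₁ n v' S' h _ ih =>
    rw [add_right_comm]
    exact .step (l₁ := some l₁) (by simp [loop, stepAux_relabel, h]) (ih hr')

end Fragment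

end Fragments

end QuantumProofs

namespace QuantumProofs
open Turing Function

/-! ### Loops that consume a stack -/

section PopLoop

variable {K : Type} {Γ : K → Type} {σ : Type} [DecidableEq K]

namespace Fragment

/-- Pops stack `k` and stores the result in the internal state by `set`; performs the body and
repeats as long as `test` holds for the new internal state. -/
def popLoop (k : K) (set : σ → Option (Γ k) → σ) (test : σ → Bool) (P : Fragment K Γ σ) :
    Fragment K Γ σ :=
  loop (.pop k set (.branch test (.goto fun _ => true) (.goto fun _ => false))) P

/-- The rule for a loop that consumes the stack `k`. The stacks are `F p l` when `p` has been
consumed and `l` is still to be read, and `V p` is the internal state at that time, up to the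
register that is overwritten by the next pop. -/
theorem run_popLoop {k : K} {set : σ → Option (Γ k) → σ} {test : σ → Bool} {P : Fragment K Γ σ}
    (F : List (Γ k) → List (Γ k) → ∀ k, List (Γ k)) (V : List (Γ k) → σ) {l₀ : List (Γ k)} {t : ℕ}
    (hF : ∀ p l, F p l k = l) (hsome : ∀ p b, test (set (V p) (some b)) = true)
    (hnone : ∀ p, test (set (V p) none) = false)
    (hP : ∀ p b l, p ++ b :: l = l₀ → ∃ v, set v = set (V (p ++ [b])) ∧
      P.Run (set (V p) (some b)) (update (F p (b :: l)) k l) v (F (p ++ [b]) l) t) :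
    (popLoop k set test P).Run (V []) (F [] l₀) (set (V l₀) none) (F l₀ [])
      (l₀.length * (t + 1) + 1) := by
  suffices h : ∀ l p v, p ++ l = l₀ → set v = set (V p) →
      (popLoop k set test P).Run v (F p l) (set (V l₀) none) (F l₀ []) (l.length * (t + 1) + 1) from
    h l₀ [] _ rfl rfl
  intro l
  induction l with
  | nil =>
    intro p v hp hv
    rw [List.append_nil] at hp
    subst hp
    refine (run_loop_exit ?_).mono (by simp)
    have h0 : update (F p []) k [] = F p [] := by
      conv_rhs => rw [← update_eq_self k (F p []), hF]
    simp [hF, hv, hnone, h0]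
  | cons b l ih =>
    intro p v hp hv
    obtain ⟨v', hv', hr⟩ := hP p b l hp
    refine (run_loop_step ?_ hr (ih (p ++ [b]) v' (by simpa using hp) hv')).mono ?_
    · simp [hF, hv, hsome]
    · simp only [List.length_cons]
      linarith

end Fragment

end PopLoop

/-! ### Fragments and machines -/

section Machines

/-- The stack contents with `s` on stack `k` and all other stacks empty. -/
def onlyStk {K : Type} {Γ : K → Type} [DecidableEq K] (k : K) (s : List (Γ k)) :
    ∀ k, List (Γ k) :=
  update (fun _ => []) k s

theorem initList_eq (tm : FinTM2) (s : List (tm.Γ tm.k₀)) :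
    initList tm s = ⟨some tm.main, tm.initialState, onlyStk tm.k₀ s⟩ := by
  unfold initList onlyStk
  congr 1
  funext k
  by_cases h : k = tm.k₀
  · subst h; simp
  · simp [h]

theorem haltList_eq (tm : FinTM2) (s : List (tm.Γ tm.k₁)) :
    haltList tm s = ⟨none, tm.initialState, onlyStk tm.k₁ s⟩ := by
  unfold haltList onlyStk
  congr 1
  funext k
  by_cases h : k = tm.k₁
  · subst h; simp
  · simp [h]

namespace Fragment

/-- A machine as a fragment that is left when the machine halts. -/
def ofMachine (tm : FinTM2) : Fragment tm.K tm.Γ tm.σ :=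
  letI := tm.ΛFin
  { Λ := tm.Λ
    entry := tm.main
    code := fun l => exitOnHalt (tm.m l) }

theorem reach_ofMachine (tm : FinTM2) {n : ℕ} {l : tm.Λ} {v v' : tm.σ}
    {S S' : ∀ k, List (tm.Γ k)}
    (h : (flip bind (TM2.step tm.m))^[n] (some ⟨some l, v, S⟩) = some ⟨none, v', S'⟩) :
    (ofMachine tm).Reach l v S n v' S' := by
  have hnone : ∀ n, (flip bind (TM2.step tm.m))^[n] none = none := fun n => by
    induction n with
    | zero => rfl
    | succ n ih => exact ih
  induction n generalizing l v S with
  | zero => simp at h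
  | succ n ih =>
    have h : (flip bind (TM2.step tm.m))^[n] (some (TM2.stepAux (tm.m l) v S)) = _ := h
    rcases hc : TM2.stepAux (tm.m l) v S with ⟨l₁, v₁, S₁⟩
    rw [hc] at h
    cases l₁ with
    | some l₁ => exact .step (by simp [ofMachine, stepAux_exitOnHalt, hc]) (ih h)
    | none =>
      cases n with
      | zero =>
        simp only [iterate_zero, id_eq, Option.some.injEq, TM2.Cfg.mk.injEq, true_and] at h
        exact .exit (by simp [ofMachine, stepAux_exitOnHalt, hc, h])
      | succ n => exact absurd ((hnone n).symm.trans h) (by simp)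

/-- The machine that runs a fragment and then halts. -/
def toMachine {K : Type} {Γ : K → Type} {σ : Type} [DecidableEq K] [Fintype K] [Fintype σ]
    (P : Fragment K Γ σ) (k₀ k₁ : K) [Fintype (Γ k₀)] (v₀ : σ) : FinTM2 where
  k₀ := k₀
  k₁ := k₁
  Γ := Γ
  Λ := Option P.Λ
  main := some P.entry
  σ := σ
  initialState := v₀
  m
    | some l => P.code l
    | none => .halt

theorem iterate_toMachine {K : Type} {Γ : K → Type} {σ : Type} [DecidableEq K] [Fintype K]
    [Fintype σ] {P : Fragment K Γ σ} (k₀ k₁ : K) [Fintype (Γ k₀)] (v₀ : σ) {l : P.Λ} {v v' : σ}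
    {S S' : ∀ k, List (Γ k)} {n : ℕ} (h : P.Reach l v S n v' S') :
    (flip bind (P.toMachine k₀ k₁ v₀).step)^[n + 1]
      (some (⟨some (some l), v, S⟩ : TM2.Cfg Γ (Option P.Λ) σ)) =
      some (⟨none, v', S'⟩ : TM2.Cfg Γ (Option P.Λ) σ) := by
  induction h with
  | @exit l v S v' S' h =>
    have h1 : flip bind (P.toMachine k₀ k₁ v₀).step
        (some (⟨some (some l), v, S⟩ : TM2.Cfg Γ (Option P.Λ) σ)) =
        some (TM2.stepAux (P.code l) v S) := rfl
    rw [iterate_succ_apply, h1, h]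
    rfl
  | @step l v S l₁ v₁ S₁ n v' S' h _ ih =>
    have h1 : flip bind (P.toMachine k₀ k₁ v₀).step
        (some (⟨some (some l), v, S⟩ : TM2.Cfg Γ (Option P.Λ) σ)) =
        some (TM2.stepAux (P.code l) v S) := rfl
    rw [iterate_succ_apply, h1, h]
    exact ih

end Fragment

/-- A function is computable in polynomial time if a fragment computes it within a polynomial time
bound and leaves its internal state and all stacks but the output clean. -/
theorem isPolyTime_of_run {K : Type} {Γ : K → Type} {σ : Type} [DecidableEq K] [Fintype K]
    [Fintype σ] (P : Fragment K Γ σ) {k₀ k₁ : K} (e₀ : Γ k₀ ≃ Bool) (e₁ : Γ k₁ ≃ Bool) (v₀ : σ)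
    {f : List Bool → List Bool} (p : Polynomial ℕ)
    (h : ∀ x, P.Run v₀ (onlyStk k₀ (x.map e₀.symm)) v₀ (onlyStk k₁ ((f x).map e₁.symm))
      (p.eval x.length)) : IsPolyTime f := by
  let _ : Fintype (Γ k₀) := Fintype.ofEquiv _ e₀.symm
  refine ⟨{ tm := P.toMachine k₀ k₁ v₀, inputAlphabet := e₀, outputAlphabet := e₁, time := p + 1,
            outputsFun := fun x => Classical.choice ?_ }⟩
  obtain ⟨n, hn, hr⟩ := h x
  refine ⟨⟨⟨n + 1, ?_⟩, ?_⟩⟩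
  · rw [initList_eq]
    refine (Fragment.iterate_toMachine k₀ k₁ v₀ hr).trans ?_
    exact congrArg some (haltList_eq (P.toMachine k₀ k₁ v₀) _).symm
  · simpa using hn

end Machines

/-! ### Growth of the stacks -/

section Growth

/-- A bound for the number of symbols that a statement pushes. -/
def pushCount {K : Type} {Γ : K → Type} {L σ : Type} : TM2.Stmt Γ L σ → ℕ
  | .push _ _ q => pushCount q + 1
  | .peek _ _ q => pushCount q
  | .pop _ _ q => pushCount q
  | .load _ q => pushCount q
  | .branch _ q₁ q₂ => max (pushCount q₁) (pushCount q₂)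
  | .goto _ => 0
  | .halt => 0

variable {K : Type} {Γ : K → Type} {σ : Type} [DecidableEq K]

theorem length_stepAux_le {L : Type} (q : TM2.Stmt Γ L σ) (v : σ) (S : ∀ k, List (Γ k)) (k : K) :
    ((TM2.stepAux q v S).stk k).length ≤ (S k).length + pushCount q := by
  induction q generalizing v S with
  | push k' f q ih =>
    refine (ih _ _).trans ?_
    by_cases h : k = k'
    · subst h; simp [pushCount]; omega
    · simp [pushCount, h]
  | pop k' f q ih =>
    refine (ih _ _).trans ?_
    by_cases h : k = k'
    · subst h; simp [pushCount]
    · simp [pushCount, h]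
  | branch p q₁ q₂ h₁ h₂ =>
    cases h : p v
    · simpa [h, pushCount] using (h₂ v S).trans (by omega)
    · simpa [h, pushCount] using (h₁ v S).trans (by omega)
  | peek _ _ _ ih => exact ih _ _
  | load _ _ ih => exact ih _ _
  | _ => simp

/-- The stacks grow at most linearly with time, so the output of a machine that runs in polynomial
time has polynomial length. -/
theorem Fragment.length_le_of_run (P : Fragment K Γ σ) :
    ∃ c, ∀ v S v' S' t, P.Run v S v' S' t → ∀ k, (S' k).length ≤ (S k).length + c * t := by
  refine ⟨Finset.univ.sup fun l => pushCount (P.code l), ?_⟩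
  set c := Finset.univ.sup fun l => pushCount (P.code l) with hc
  have hle : ∀ l, pushCount (P.code l) ≤ c := fun l =>
    Finset.le_sup (f := fun l => pushCount (P.code l)) (Finset.mem_univ l)
  rintro v S v' S' t ⟨n, hn, hr⟩ k
  suffices h : (S' k).length ≤ (S k).length + c * n from
    h.trans (Nat.add_le_add_left (Nat.mul_le_mul_left c hn) _)
  clear hn
  generalize P.entry = l at hr
  induction hr with
  | @exit l v S v' S' h =>
    have := length_stepAux_le (P.code l) v S k
    rw [h] at this
    have := hle l
    simp only [mul_one]
    dsimp only at *
    omega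
  | @step l v S l₁ v₁ S₁ n v' S' h _ ih =>
    have := length_stepAux_le (P.code l) v S k
    rw [h] at this
    have := hle l
    simp only [mul_add, mul_one]
    dsimp only at *
    omega

end Growth

/-! ### Two families of stacks -/

section Lift

variable {K₁ K₂ : Type} {Γ₁ : K₁ → Type} {Γ₂ : K₂ → Type} {σ₁ σ₂ : Type}

/-- The contents of two disjoint families of stacks, put together. -/
def joinStk (S₁ : ∀ k, List (Γ₁ k)) (S₂ : ∀ k, List (Γ₂ k)) :
    ∀ k : K₁ ⊕ K₂, List (Sum.elim Γ₁ Γ₂ k)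
  | .inl k => S₁ k
  | .inr k => S₂ k

/-- Lets a statement act on the first of two families of stacks. -/
def liftLeft {L : Type} : TM2.Stmt Γ₁ L σ₁ → TM2.Stmt (Sum.elim Γ₁ Γ₂) L (σ₁ × σ₂)
  | .push k f q => .push (.inl k) (fun v => f v.1) (liftLeft q)
  | .peek k f q => .peek (.inl k) (fun v o => (f v.1 o, v.2)) (liftLeft q)
  | .pop k f q => .pop (.inl k) (fun v o => (f v.1 o, v.2)) (liftLeft q)
  | .load f q => .load (fun v => (f v.1, v.2)) (liftLeft q)
  | .branch p q₁ q₂ => .branch (fun v => p v.1) (liftLeft q₁) (liftLeft q₂)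
  | .goto f => .goto fun v => f v.1
  | .halt => .halt

/-- Lets a statement act on the second of two families of stacks. -/
def liftRight {L : Type} : TM2.Stmt Γ₂ L σ₂ → TM2.Stmt (Sum.elim Γ₁ Γ₂) L (σ₁ × σ₂)
  | .push k f q => .push (.inr k) (fun v => f v.2) (liftRight q)
  | .peek k f q => .peek (.inr k) (fun v o => (v.1, f v.2 o)) (liftRight q)
  | .pop k f q => .pop (.inr k) (fun v o => (v.1, f v.2 o)) (liftRight q)
  | .load f q => .load (fun v => (v.1, f v.2)) (liftRight q)
  | .branch p q₁ q₂ => .branch (fun v => p v.2) (liftRight q₁) (liftRight q₂)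
  | .goto f => .goto fun v => f v.2
  | .halt => .halt

variable [DecidableEq K₁] [DecidableEq K₂]

theorem update_joinStk_inl (S₁ : ∀ k, List (Γ₁ k)) (S₂ : ∀ k, List (Γ₂ k)) (k : K₁)
    (s : List (Γ₁ k)) :
    update (joinStk S₁ S₂) (.inl k) s = joinStk (update S₁ k s) S₂ := by
  funext j
  rcases j with j | j
  · by_cases h : j = k
    · subst h
      exact (update_self ..).trans (update_self (β := fun k => List (Γ₁ k)) ..).symm
    · exact (update_of_ne (by simpa using h) ..).trans (update_of_ne h ..).symm
  · exact update_of_ne (by simp) ..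

theorem update_joinStk_inr (S₁ : ∀ k, List (Γ₁ k)) (S₂ : ∀ k, List (Γ₂ k)) (k : K₂)
    (s : List (Γ₂ k)) :
    update (joinStk S₁ S₂) (.inr k) s = joinStk S₁ (update S₂ k s) := by
  funext j
  rcases j with j | j
  · exact update_of_ne (by simp) ..
  · by_cases h : j = k
    · subst h
      exact (update_self ..).trans (update_self (β := fun k => List (Γ₂ k)) ..).symm
    · exact (update_of_ne (by simpa using h) ..).trans (update_of_ne h ..).symm

theorem stepAux_liftLeft {L : Type} (q : TM2.Stmt Γ₁ L σ₁) (v₁ : σ₁) (v₂ : σ₂)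
    (S₁ : ∀ k, List (Γ₁ k)) (S₂ : ∀ k, List (Γ₂ k)) :
    TM2.stepAux (liftLeft (Γ₂ := Γ₂) q) (v₁, v₂) (joinStk S₁ S₂) =
      ⟨(TM2.stepAux q v₁ S₁).l, ((TM2.stepAux q v₁ S₁).var, v₂),
        joinStk (TM2.stepAux q v₁ S₁).stk S₂⟩ := by
  induction q generalizing v₁ S₁ with
  | push k f q ih => exact (congrArg _ (update_joinStk_inl ..)).trans (ih _ _)
  | pop k f q ih => exact (congrArg _ (update_joinStk_inl ..)).trans (ih _ _)
  | branch p q₁ q₂ h₁ h₂ => cases h : p v₁ <;> simp [liftLeft, h, h₁, h₂]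
  | peek k f q ih => exact ih _ _
  | load f q ih => exact ih _ _
  | _ => simp [liftLeft]

theorem stepAux_liftRight {L : Type} (q : TM2.Stmt Γ₂ L σ₂) (v₁ : σ₁) (v₂ : σ₂)
    (S₁ : ∀ k, List (Γ₁ k)) (S₂ : ∀ k, List (Γ₂ k)) :
    TM2.stepAux (liftRight (Γ₁ := Γ₁) q) (v₁, v₂) (joinStk S₁ S₂) =
      ⟨(TM2.stepAux q v₂ S₂).l, (v₁, (TM2.stepAux q v₂ S₂).var),
        joinStk S₁ (TM2.stepAux q v₂ S₂).stk⟩ := by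
  induction q generalizing v₂ S₂ with
  | push k f q ih => exact (congrArg _ (update_joinStk_inr ..)).trans (ih _ _)
  | pop k f q ih => exact (congrArg _ (update_joinStk_inr ..)).trans (ih _ _)
  | branch p q₁ q₂ h₁ h₂ => cases h : p v₂ <;> simp [liftRight, h, h₁, h₂]
  | peek k f q ih => exact ih _ _
  | load f q ih => exact ih _ _
  | _ => simp [liftRight]

namespace Fragment

/-- A fragment on the first of two families of stacks. -/
def left (P : Fragment K₁ Γ₁ σ₁) (Γ₂ : K₂ → Type) (σ₂ : Type) :
    Fragment (K₁ ⊕ K₂) (Sum.elim Γ₁ Γ₂) (σ₁ × σ₂) where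
  Λ := P.Λ
  entry := P.entry
  code l := liftLeft (P.code l)

/-- A fragment on the second of two families of stacks. -/
def right (P : Fragment K₂ Γ₂ σ₂) (Γ₁ : K₁ → Type) (σ₁ : Type) :
    Fragment (K₁ ⊕ K₂) (Sum.elim Γ₁ Γ₂) (σ₁ × σ₂) where
  Λ := P.Λ
  entry := P.entry
  code l := liftRight (P.code l)

theorem run_left {P : Fragment K₁ Γ₁ σ₁} {v v' : σ₁} {S S' : ∀ k, List (Γ₁ k)} {t : ℕ}
    (h : P.Run v S v' S' t) (w : σ₂) (R : ∀ k, List (Γ₂ k)) :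
    (P.left Γ₂ σ₂).Run (v, w) (joinStk S R) (v', w) (joinStk S' R) t := by
  obtain ⟨n, hn, hr⟩ := h
  refine ⟨n, hn, ?_⟩
  change (P.left Γ₂ σ₂).Reach P.entry _ _ _ _ _
  generalize P.entry = l at hr
  clear hn
  induction hr with
  | exit h => exact .exit (by simp [left, stepAux_liftLeft, h])
  | step h _ ih => exact .step (by simp only [left, stepAux_liftLeft, h]) ih

theorem run_right {P : Fragment K₂ Γ₂ σ₂} {v v' : σ₂} {S S' : ∀ k, List (Γ₂ k)} {t : ℕ}
    (h : P.Run v S v' S' t) (w : σ₁) (R : ∀ k, List (Γ₁ k)) :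
    (P.right Γ₁ σ₁).Run (w, v) (joinStk R S) (w, v') (joinStk R S') t := by
  obtain ⟨n, hn, hr⟩ := h
  refine ⟨n, hn, ?_⟩
  change (P.right Γ₁ σ₁).Reach P.entry _ _ _ _ _
  generalize P.entry = l at hr
  clear hn
  induction hr with
  | exit h => exact .exit (by simp [right, stepAux_liftRight, h])
  | step h _ ih => exact .step (by simp only [right, stepAux_liftRight, h]) ih

end Fragment

end Lift

end QuantumProofs

namespace QuantumProofs
open Turing Function

/-! ### Programs on bit strings -/

section Programs

/-- The stacks of the circuit-rewriting programs. The unary counters `P`, `Q`, `L`, `C`, `N`, `D`,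
`A` hold strings of ones. -/
inductive Stk
  | inp | out | y | tmp | P | Q | L | C | N | D | A
  deriving DecidableEq

instance : Fintype Stk :=
  ⟨{.inp, .out, .y, .tmp, .P, .Q, .L, .C, .N, .D, .A}, fun k => by cases k <;> decide⟩

/-- The position inside the code of a gate: `k c` while the kind is being read and `c` ones have
been seen, `a r` when `r` wire numbers are still to come. -/
inductive Phase
  | k0 | k1 | k2 | k3 | k4 | k5 | a1 | a2 | a3
  deriving DecidableEq

instance : Fintype Phase :=
  ⟨{.k0, .k1, .k2, .k3, .k4, .k5, .a1, .a2, .a3}, fun k => by cases k <;> decide⟩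

/-- The internal states: the symbol that was popped last, and a position in the code of a gate. -/
abbrev Reg : Type := Option Bool × Phase

/-- Contents of all stacks. -/
structure Contents where
  inp : List Bool := []
  out : List Bool := []
  y : List Bool := []
  tmp : List Bool := []
  P : List Bool := []
  Q : List Bool := []
  L : List Bool := []
  C : List Bool := []
  N : List Bool := []
  D : List Bool := []
  A : List Bool := []

/-- The contents as a function of the stack. -/
def Contents.get (s : Contents) : Stk → List Bool
  | .inp => s.inp | .out => s.out | .y => s.y | .tmp => s.tmp | .P => s.P | .Q => s.Q | .L => s.L
  | .C => s.C | .N => s.N | .D => s.D | .A => s.A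

/-- Replaces the contents of one stack. -/
def Contents.set (s : Contents) (k : Stk) (l : List Bool) : Contents :=
  match k with
  | .inp => { s with inp := l }
  | .out => { s with out := l }
  | .y => { s with y := l }
  | .tmp => { s with tmp := l }
  | .P => { s with P := l }
  | .Q => { s with Q := l }
  | .L => { s with L := l }
  | .C => { s with C := l }
  | .N => { s with N := l }
  | .D => { s with D := l }
  | .A => { s with A := l }

theorem Contents.update_get (s : Contents) (k : Stk) (l : List Bool) :
    update s.get k l = (s.set k l).get := by
  funext j
  cases k <;> cases j <;> rfl

/-- The programs that rewrite circuits. -/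
abbrev Program : Type 1 := Fragment Stk (fun _ => Bool) Reg

namespace Program

open Fragment

/-- Pushes the word `w` and continues with `q`. -/
def wordStmt {L : Type} (k : Stk) :
    List Bool → TM2.Stmt (fun _ : Stk => Bool) L Reg → TM2.Stmt (fun _ : Stk => Bool) L Reg
  | [], q => q
  | b :: w, q => wordStmt k w (.push k (fun _ => b) q)

theorem stepAux_wordStmt {L : Type} (k : Stk) (w : List Bool)
    (q : TM2.Stmt (fun _ : Stk => Bool) L Reg) (v : Reg) (S : Stk → List Bool) :
    TM2.stepAux (wordStmt k w q) v S = TM2.stepAux q v (update S k (w ++ S k)) := by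
  induction w generalizing q with
  | nil => simp [wordStmt]
  | cons b w ih => simp [wordStmt, ih]

/-- Pushes the word `w`, so that it ends up on top with its first letter first. -/
def word (k : Stk) (w : List Bool) : Program := single (wordStmt k w (.goto fun _ => none))

theorem run_word (k : Stk) (w : List Bool) (v : Reg) (S : Stk → List Bool) :
    (word k w).Run v S v (update S k (w ++ S k)) 1 :=
  run_single (by simp [stepAux_wordStmt])

/-- Does nothing. -/
def skip : Program := single (.goto fun _ => none)

theorem run_skip (v : Reg) (S : Stk → List Bool) : skip.Run v S v S 1 :=
  run_single (by simp)

/-- Removes the top symbol of a stack. -/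
def drop (k : Stk) : Program := single (.pop k (fun v _ => v) (.goto fun _ => none))

theorem run_drop (k : Stk) (v : Reg) (S : Stk → List Bool) :
    (drop k).Run v S v (update S k (S k).tail) 1 :=
  run_single (by simp)

/-- Pops the symbols of the stack `k` one by one and performs the body after each of them. -/
def forEach (k : Stk) (P : Program) : Program :=
  popLoop k (fun v o => (o, v.2)) (fun v => v.1.isSome) P

theorem run_forEach {k : Stk} {P : Program} (F : List Bool → List Bool → Stk → List Bool)
    (φ : List Bool → Phase) {l₀ : List Bool} {t : ℕ} (r : Option Bool)
    (hF : ∀ p l, F p l k = l)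
    (hP : ∀ p b l, p ++ b :: l = l₀ → ∃ r, P.Run (some b, φ p) (update (F p (b :: l)) k l)
      (r, φ (p ++ [b])) (F (p ++ [b]) l) t) :
    (forEach k P).Run (r, φ []) (F [] l₀) (none, φ l₀) (F l₀ []) (l₀.length * (t + 1) + 1) := by
  have h := run_popLoop (k := k) (set := fun (v : Reg) o => (o, v.2)) (test := fun v => v.1.isSome)
    (P := P) F (fun p => (r, φ p)) (l₀ := l₀) (t := t) hF (by simp) (by simp)
    (fun p b l hp => by
      obtain ⟨r', hr⟩ := hP p b l hp
      exact ⟨(r', φ (p ++ [b])), rfl, hr⟩)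
  exact h

/-- Empties the stack `k`. -/
def clear (k : Stk) : Program := forEach k skip

theorem run_clear (k : Stk) (r : Option Bool) (φ : Phase) (S : Stk → List Bool) :
    (clear k).Run (r, φ) S (none, φ) (update S k []) (2 * (S k).length + 1) := by
  have h := run_forEach (k := k) (P := skip) (fun _ l => update S k l) (fun _ => φ) (l₀ := S k)
    (t := 1) r (by simp) (fun p b l _ => ⟨some b, by simpa using run_skip _ _⟩)
  rw [update_eq_self] at h
  exact h.mono (by omega)

/-- Moves the contents of stack `a` onto stack `b`, in reversed order. -/
def pour (a b : Stk) : Program :=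
  forEach a (single (.push b (fun v => v.1.getD false) (.goto fun _ => none)))

theorem run_pour {a b : Stk} (r : Option Bool) (φ : Phase) (S : Stk → List Bool)
    (hab : a ≠ b := by decide) :
    (pour a b).Run (r, φ) S (none, φ) (update (update S a []) b ((S a).reverse ++ S b))
      (2 * (S a).length + 1) := by
  have h := run_forEach (k := a)
    (P := single (.push b (fun v => v.1.getD false) (.goto fun _ => none)))
    (fun p l => update (update S a l) b (p.reverse ++ S b)) (fun _ => φ) (l₀ := S a)
    (t := 1) r (by simp [hab]) (fun p c l _ => ⟨some c, run_single (by
      simp only [TM2.stepAux, Option.getD_some]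
      congr 1
      funext j
      simp only [update_apply]
      split_ifs <;> simp_all)⟩)
  simp only [List.reverse_nil, List.nil_append, update_eq_self] at h
  exact h.mono (by omega)

/-- Pushes a copy of the unary counter `c` onto stack `k`. -/
def emit (c k : Stk) : Program :=
  forEach c (word .tmp [true] ⨟ word k [true]) ⨟ pour .tmp c

theorem run_emit {c k : Stk} {a : ℕ} {S : Stk → List Bool} (hc : S c = List.replicate a true)
    (ht : S .tmp = []) (r : Option Bool) (φ : Phase) (hct : c ≠ .tmp := by decide)
    (hkt : k ≠ .tmp := by decide) (hck : c ≠ k := by decide) :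
    (emit c k).Run (r, φ) S (none, φ) (update S k (List.replicate a true ++ S k)) (5 * a + 2) := by
  have h := run_forEach (k := c) (P := word .tmp [true] ⨟ word k [true])
    (fun p l => update (update (update S c l) .tmp (List.replicate p.length true)) k
      (List.replicate p.length true ++ S k)) (fun _ => φ) (l₀ := S c) (t := 2) r
    (by simp [hct, hck]) (fun p b l _ => ⟨some b, (run_seq (run_word .tmp [true] _ _)
      (run_word k [true] _ _)).of_eq rfl (by
        funext j
        simp only [update_apply]
        split_ifs <;> simp_all [List.replicate_succ]) le_rfl⟩)
  have h2 := run_seq h (run_pour none φ _ hct.symm)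
  have h0 : update (update (update S c (S c)) .tmp (List.replicate ([] : List Bool).length true)) k
      (List.replicate ([] : List Bool).length true ++ S k) = S := by
    funext j
    simp only [update_apply]
    split_ifs <;> simp_all
  rw [h0] at h2
  refine h2.of_eq rfl ?_ ?_
  · funext j
    simp only [update_apply]
    split_ifs <;> simp_all
  · simp [hc, hkt.symm]
    omega

end Program

end Programs

end QuantumProofs

namespace QuantumProofs
open Turing Function

/-! ### The programs that rewrite circuits -/

section Passes

/-- Splits off the first unary number of a bit string. A missing terminator is tolerated. -/
def splitUnary : List Bool → ℕ × List Bool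
  | [] => (0, [])
  | true :: l => ((splitUnary l).1 + 1, (splitUnary l).2)
  | false :: l => (0, l)

theorem splitUnary_le (l : List Bool) :
    (splitUnary l).1 ≤ l.length ∧ (splitUnary l).2.length ≤ l.length := by
  induction l with
  | nil => simp [splitUnary]
  | cons b l ih =>
    cases b
    · simp [splitUnary]
    · simp [splitUnary]; omega

theorem splitUnary_encodeNats (a : ℕ) (l : List ℕ) :
    splitUnary (encodeNats (a :: l)) = (a, encodeNats l) := by
  rw [encodeNats_cons]
  induction a with
  | zero => simp [splitUnary]
  | succ a ih => simp [List.replicate_succ, splitUnary, ih]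

/-- One step of the pass that turns the bits of a string into `X` gates: the state consists of the
wire of the current bit and of the code that has been written so far. -/
def wipeStep (s : ℕ × List Bool) (b : Bool) : ℕ × List Bool :=
  (s.1 + 1, if b then encodeNats [0, s.1] ++ s.2 else s.2)

theorem wipe_fst (p : List Bool) (s : ℕ × List Bool) :
    (p.foldl wipeStep s).1 = s.1 + p.length := by
  induction p generalizing s with
  | nil => rfl
  | cons b p ih => simp [ih, wipeStep]; omega

/-- The next position in the code of a gate. -/
def Phase.next : Phase → Bool → Phase
  | .k0, true => .k1
  | .k1, true => .k2
  | .k2, true => .k3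
  | .k3, true => .k4
  | .k4, true => .k5
  | .k5, true => .k5
  | .k4, false => .a2
  | .k5, false => .a3
  | .k0, false => .a1
  | .k1, false => .a1
  | .k2, false => .a1
  | .k3, false => .a1
  | φ, true => φ
  | .a3, false => .a2
  | .a2, false => .a1
  | .a1, false => .k0

/-- What becomes of the buffer, which holds the code of the inverse gate in reversed order. The
kinds `2` and `3`, of the mutually inverse gates `T` and `T⁻¹`, are exchanged. -/
def Phase.buffer : Phase → Bool → List Bool → List Bool
  | .k2, false, l => false :: true :: l
  | .k3, false, l => false :: l.tail
  | _, b, l => b :: l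

/-- One step of the pass that inverts a circuit: the state consists of a position in the code of a
gate, a buffer, and the code that has been written so far. -/
def invStep (s : Phase × List Bool × List Bool) (b : Bool) : Phase × List Bool × List Bool :=
  if s.1.next b = .k0 then (.k0, [], (s.1.buffer b s.2.1).reverse ++ s.2.2)
  else (s.1.next b, s.1.buffer b s.2.1, s.2.2)

theorem length_buffer_le (φ : Phase) (b : Bool) (l : List Bool) :
    (φ.buffer b l).length ≤ l.length + 2 := by
  cases φ <;> cases b <;> simp only [Phase.buffer, List.length_cons, List.length_tail] <;> omega

theorem inv_buffer_le (p : List Bool) (o : List Bool) :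
    (p.foldl invStep (.k0, [], o)).2.1.length ≤ 2 * p.length := by
  induction p using List.reverseRecOn with
  | nil => simp
  | append_singleton p b ih =>
    rw [List.foldl_append, List.foldl_cons, List.foldl_nil, invStep]
    split_ifs
    · simp
    · have := length_buffer_le (p.foldl invStep (.k0, [], o)).1 b
        (p.foldl invStep (.k0, [], o)).2.1
      simp only [List.length_append, List.length_cons, List.length_nil]
      omega

/-- The code of the gates that compute the conjunction of the negations of wires
`c - k, …, c - 1`, with the intermediate results on wires `a - k, …, a`; the last gate comes last,
and `o` follows. -/
def chainCode (c a : ℕ) (o : List Bool) : ℕ → List Bool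
  | 0 => o
  | k + 1 => encodeNats [0, c - k - 1, 5, a - k - 1, c - k - 1, a - k] ++ chainCode c a o k

namespace Program

open Fragment

/-- Removes the first unary number of the stack `y` and pushes it onto `k`. -/
def readUnary (k : Stk) : Program :=
  loop (.pop .y (fun v o => (o, v.2))
    (.branch (fun v => v.1 == some true) (.goto fun _ => true) (.goto fun _ => false)))
    (word k [true]) ⨟ single (.load (fun v => (none, v.2)) (.goto fun _ => none))

theorem run_readUnary {k : Stk} (r : Option Bool) (φ : Phase) (S : Stk → List Bool)
    (hk : k ≠ .y := by decide) :
    (readUnary k).Run (r, φ) S (none, φ) (update (update S .y (splitUnary (S .y)).2) k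
      (List.replicate (splitUnary (S .y)).1 true ++ S k)) (2 * (S .y).length + 2) := by
  suffices h : ∀ l r S, S .y = l → ∃ r', (loop (.pop .y (fun (v : Reg) o => (o, v.2))
      (.branch (fun v => v.1 == some true) (.goto fun _ => true) (.goto fun _ => false)))
      (word k [true])).Run (r, φ) S (r', φ) (update (update S .y (splitUnary l).2) k
      (List.replicate (splitUnary l).1 true ++ S k)) (2 * l.length + 1) by
    obtain ⟨r', hr⟩ := h _ r S rfl
    exact (run_seq hr (run_single (v' := (none, φ)) (by simp))).of_eq rfl rfl le_rfl
  intro l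
  induction l with
  | nil =>
    intro r S hS
    refine ⟨none, (run_loop_exit (v' := (none, φ)) (by simp [hS]; rfl)).of_eq rfl ?_ (by simp)⟩
    funext j
    simp only [update_apply]
    split_ifs <;> simp_all [splitUnary]
  | cons b l ih =>
    intro r S hS
    cases b with
    | false =>
      refine ⟨some false, (run_loop_exit (v' := (some false, φ)) (by simp [hS]; rfl)).of_eq rfl ?_
        (by simp)⟩
      funext j
      simp only [update_apply]
      split_ifs <;> simp_all [splitUnary]
    | true =>
      obtain ⟨r', hr⟩ := ih (some true)
        (update (update S .y l) k ([true] ++ update S .y l k)) (by simp [hk.symm])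
      refine ⟨r', (run_loop_step (v₂ := (some true, φ)) (S₂ := update S .y l) (by simp [hS])
        (run_word k [true] _ _) hr).of_eq rfl ?_ (by simp; omega)⟩
      funext j
      simp only [update_apply]
      split_ifs <;> simp_all [splitUnary, List.replicate_succ']

/-- Writes an `X` gate on the wire given by the counter `C` if the current bit is `1`, and increases
the counter. -/
def wipeBit : Program :=
  cond (.branch (fun v => v.1 == some true) (.goto fun _ => true) (.goto fun _ => false))
    (word .out [false] ⨟ emit .C .out ⨟ word .out [false]) skip ⨟ word .C [true]

/-- Writes an `X` gate for each `1` in the input. -/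
def wipe : Program := forEach .inp wipeBit

theorem run_wipe (s : Contents) (c : ℕ) (hC : s.C = List.replicate c true) (ht : s.tmp = [])
    (r : Option Bool) (φ : Phase) :
    wipe.Run (r, φ) s.get (none, φ) { s with
      inp := []
      C := List.replicate (c + s.inp.length) true
      out := (s.inp.foldl wipeStep (c, s.out)).2 : Contents }.get
      (s.inp.length * (5 * (c + s.inp.length) + 7) + 1) := by
  have h := run_forEach (k := .inp) (P := wipeBit)
    (fun p l => { s with
      inp := l
      C := List.replicate (p.foldl wipeStep (c, s.out)).1 true
      out := (p.foldl wipeStep (c, s.out)).2 : Contents }.get) (fun _ => φ) (l₀ := s.inp)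
    (t := 5 * (c + s.inp.length) + 6) r (fun _ _ => rfl) (by
      intro p b l hp
      have hlen : p.length ≤ s.inp.length := by
        have := congrArg List.length hp
        simp at this
        omega
      have hfst := wipe_fst p (c, s.out)
      rw [List.foldl_append, List.foldl_cons, List.foldl_nil]
      generalize p.foldl wipeStep (c, s.out) = w at hfst ⊢
      rw [Contents.update_get]
      cases b with
      | false =>
        refine ⟨some false, ((run_seq (run_cond_false (by simp; rfl) (run_skip _ _))
          (run_word .C [true] _ _)).of_eq rfl ?_ ?_)⟩
        · rw [Contents.update_get]
          simp [Contents.set, Contents.get, wipeStep, List.replicate_succ]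
        · omega
      | true =>
        have h2 := run_seq (run_word .out [false] (some true, φ) { s with
          inp := l
          C := List.replicate w.1 true
          out := w.2 : Contents }.get) (run_seq (run_emit (c := .C) (k := .out) (a := w.1)
            (by simp [Contents.get]) (by simp [Contents.get, ht]) _ _)
            (run_word .out [false] _ _))
        refine ⟨none, ((run_seq (run_cond_true (by simp; rfl) h2)
          (run_word .C [true] _ _)).of_eq rfl ?_ ?_)⟩
        · simp [Contents.update_get, Contents.set, Contents.get, wipeStep, List.replicate_succ,
            encodeNats]
        · dsimp only at hfst
          omega)
  rw [show s.get = { s with C := List.replicate c true : Contents }.get by rw [← hC]]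
  exact h.of_eq rfl (by simp [wipe_fst]) le_rfl

/-- Processes one bit of the code of a circuit that is being inverted. The last test is whether a
gate is complete; in that case it is moved from the buffer `tmp` to the output. -/
def invertBit : Program :=
  cond (.branch (fun v => v.2 = .k2 ∧ v.1 = some false)
      (wordStmt .tmp [false, true] advance)
      (.branch (fun v => v.2 = .k3 ∧ v.1 = some false)
        (.pop .tmp (fun v _ => v) (.push .tmp (fun _ => false) advance))
        (.push .tmp (fun v => v.1.getD false) advance)))
    (pour .tmp .out) skip
where
  /-- Updates the position in the code of the gate. -/
  advance : TM2.Stmt (fun _ : Stk => Bool) Bool Reg :=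
    .load (fun v => (v.1, v.2.next (v.1.getD false))) (.goto fun v => v.2 = .k0)

/-- Inverts the circuit on stack `y`, writing the inverse gates in reversed order. -/
def invert : Program :=
  forEach .y invertBit ⨟ single (.load (fun v => (v.1, .k0)) (.goto fun _ => none)) ⨟ clear .tmp

theorem run_invert (s : Contents) (ht : s.tmp = []) (r : Option Bool) :
    invert.Run (r, .k0) s.get (none, .k0) { s with
      y := []
      out := (s.y.foldl invStep (.k0, [], s.out)).2.2 : Contents }.get
      (s.y.length * (4 * s.y.length + 14) + 3) := by
  have h := run_forEach (k := .y) (P := invertBit)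
    (fun p l => { s with
      y := l
      tmp := (p.foldl invStep (.k0, [], s.out)).2.1
      out := (p.foldl invStep (.k0, [], s.out)).2.2 : Contents }.get)
    (fun p => (p.foldl invStep (.k0, [], s.out)).1) (l₀ := s.y)
    (t := 4 * s.y.length + 6) r (fun _ _ => rfl) (by
      intro p b l hp
      have hlen : p.length + 1 ≤ s.y.length := by
        have := congrArg List.length hp
        simp at this
        omega
      have hbuf := inv_buffer_le p s.out
      rw [List.foldl_append, List.foldl_cons, List.foldl_nil]
      generalize p.foldl invStep (.k0, [], s.out) = w at hbuf ⊢
      obtain ⟨φ, buf, o⟩ := w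
      dsimp only at hbuf ⊢
      rw [Contents.update_get]
      have hbuf2 := length_buffer_le φ b buf
      by_cases hk : φ.next b = .k0
      · refine ⟨none, (run_cond_true (v₂ := (some b, .k0)) (S₂ := { s with
          y := l
          tmp := φ.buffer b buf
          out := o : Contents }.get) ?_ (run_pour _ _ _)).of_eq ?_ ?_ ?_⟩
        · cases φ <;> cases b <;> simp [Phase.next] at hk ⊢
          simp [invertBit.advance, Phase.next, Contents.update_get, Contents.set,
            Contents.get, Phase.buffer]
        · simp [invStep, hk]
        · simp [invStep, hk, Contents.update_get, Contents.set, Contents.get]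
        · simp only [Contents.get]
          omega
      · refine ⟨some b, (run_cond_false (v₂ := (some b, φ.next b)) (S₂ := { s with
          y := l
          tmp := φ.buffer b buf
          out := o : Contents }.get) ?_ (run_skip _ _)).of_eq ?_ ?_ ?_⟩
        · cases φ <;> cases b <;> simp [Phase.next] at hk ⊢ <;>
          simp [invertBit.advance, stepAux_wordStmt, Contents.update_get, Contents.set,
            Contents.get, Phase.buffer, Phase.next]
        · simp [invStep, hk]
        · simp [invStep, hk]
        · omega)
  have h2 := run_seq h (run_seq (run_single (q := .load (fun v => (v.1, .k0)) (.goto fun _ => none))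
    (v' := (none, .k0)) (by simp; rfl)) (run_clear .tmp _ _ _))
  rw [show s.get = { s with tmp := [] : Contents }.get by rw [← ht]]
  refine h2.of_eq rfl ?_ ?_
  · simp [Contents.update_get, Contents.set, ht]
  · have hbuf := inv_buffer_le s.y s.out
    simp only [Contents.get]
    generalize s.y.length = n at *
    nlinarith

/-- Writes the gates of one step of the conjunction. -/
def chainStep : Program :=
  word .N [true] ⨟ word .out [false] ⨟ emit .A .out ⨟ drop .C ⨟ drop .A ⨟ word .out [false] ⨟
  emit .C .out ⨟ word .out [false] ⨟ emit .A .out ⨟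
  word .out [false, true, true, true, true, true, false] ⨟ emit .C .out ⨟ word .out [false]

/-- Writes the gates of the conjunction, and moves the counter `D` to `N`. -/
def chain : Program := forEach .D chainStep

theorem run_chain (s : Contents) (c a d : ℕ) (hC : s.C = List.replicate c true)
    (hA : s.A = List.replicate a true) (hD : s.D = List.replicate d true) (hN : s.N = [])
    (ht : s.tmp = []) (r : Option Bool) (φ : Phase) :
    chain.Run (r, φ) s.get (none, φ) { s with
      D := []
      N := List.replicate d true
      C := List.replicate (c - d) true
      A := List.replicate (a - d) true
      out := chainCode c a s.out d : Contents }.get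
      (d * (10 * a + 10 * c + 17) + 1) := by
  have h := run_forEach (k := .D) (P := chainStep)
    (fun p l => { s with
      D := l
      N := List.replicate p.length true
      C := List.replicate (c - p.length) true
      A := List.replicate (a - p.length) true
      out := chainCode c a s.out p.length : Contents }.get)
    (fun _ => φ) (l₀ := s.D) (t := 10 * a + 10 * c + 16) r (fun _ _ => rfl) (by
      intro p b l hp
      refine ⟨none, ?_⟩
      rw [Contents.update_get]
      simp only [Contents.set]
      refine run_seq_sub (run_word .N [true] _ _) ?_
      simp only [Contents.update_get, Contents.set, Contents.get]
      refine run_seq_sub (run_word .out [false] _ _) ?_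
      simp only [Contents.update_get, Contents.set, Contents.get]
      refine run_seq_sub (run_emit (c := .A) (k := .out) (a := a - p.length)
        (by simp [Contents.get]) ht _ _) ?_
      simp only [Contents.update_get, Contents.set, Contents.get]
      refine run_seq_sub (run_drop .C _ _) ?_
      simp only [Contents.update_get, Contents.set, Contents.get]
      refine run_seq_sub (run_drop .A _ _) ?_
      simp only [Contents.update_get, Contents.set, Contents.get]
      refine run_seq_sub (run_word .out [false] _ _) ?_
      simp only [Contents.update_get, Contents.set, Contents.get]
      refine run_seq_sub (run_emit (c := .C) (k := .out) (a := c - p.length - 1)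
        (by simp [Contents.get]) ht _ _) ?_
      simp only [Contents.update_get, Contents.set, Contents.get]
      refine run_seq_sub (run_word .out [false] _ _) ?_
      simp only [Contents.update_get, Contents.set, Contents.get]
      refine run_seq_sub (run_emit (c := .A) (k := .out) (a := a - p.length - 1)
        (by simp [Contents.get]) ht _ _) ?_
      simp only [Contents.update_get, Contents.set, Contents.get]
      refine run_seq_sub (run_word .out [false, true, true, true, true, true, false] _ _) ?_
      simp only [Contents.update_get, Contents.set, Contents.get]
      refine run_seq_sub (run_emit (c := .C) (k := .out) (a := c - p.length - 1)
        (by simp [Contents.get]) ht _ _) ?_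
      simp only [Contents.update_get, Contents.set, Contents.get]
      refine (run_word .out [false] _ _).of_eq rfl ?_ (by omega)
      simp [Contents.update_get, Contents.set, Contents.get, chainCode, encodeNats,
        List.replicate_succ, Nat.sub_sub])
  rw [show s.get = { s with
      N := []
      C := List.replicate c true
      A := List.replicate a true : Contents }.get by rw [← hN, ← hC, ← hA]]
  exact h.of_eq rfl (by simp [hD]) (by simp [hD, add_assoc])

/-- The program of the hardness reduction: from the input `x` (with its length on the counter `L`)
and the description of a verification circuit on `y` to an isometry circuit. -/
def fromVerifier : Program :=
  readUnary .P ⨟ readUnary .Q ⨟ emit .P .C ⨟ wipe ⨟ invert ⨟ emit .Q .C ⨟ drop .C ⨟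
  word .out [false] ⨟ emit .C .out ⨟ word .out [false, false] ⨟ pour .Q .out ⨟ pour .L .out ⨟
  word .out [false] ⨟ pour .P .out ⨟ word .out [false] ⨟ pour .C .out

/-- The output of `fromVerifier`. -/
def fromVerifierOut (x y : List Bool) : List Bool :=
  let p := (splitUnary y).1
  let q := (splitUnary (splitUnary y).2).1
  encodeNats [p + x.length + q - 1, p, x.length + q, 0, p + x.length + q - 1] ++
    ((splitUnary (splitUnary y).2).2.foldl invStep
      (.k0, [], (x.foldl wipeStep (p, [])).2)).2.2

/-- The running time of `fromVerifier`, with a generous constant. -/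
theorem run_fromVerifier (x y : List Bool) :
    fromVerifier.Run (none, .k0)
      { inp := x, y := y, L := List.replicate x.length true : Contents }.get
      (none, .k0) { out := fromVerifierOut x y : Contents }.get
      (100 * (x.length + y.length + 1) ^ 2) := by
  obtain ⟨hp, hy⟩ := splitUnary_le y
  obtain ⟨hq, hy'⟩ := splitUnary_le (splitUnary y).2
  set p := (splitUnary y).1 with hp0
  set q := (splitUnary (splitUnary y).2).1 with hq0
  set z := (splitUnary (splitUnary y).2).2 with hz
  refine run_seq_sub (run_readUnary (k := .P) _ _ _) ?_
  simp only [Contents.update_get, Contents.set, Contents.get,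
    ← hp0]
  refine run_seq_sub (run_readUnary (k := .Q) _ _ _) ?_
  simp only [Contents.update_get, Contents.set, Contents.get,
    ← hq0, ← hz, List.append_nil]
  refine run_seq_sub (run_emit (c := .P) (k := .C) (a := p) rfl rfl none .k0) ?_
  simp only [Contents.update_get, Contents.set, Contents.get,
    List.append_nil]
  refine run_seq_sub (run_wipe _ p rfl rfl _ _) ?_
  dsimp only
  refine run_seq_sub (run_invert _ rfl _) ?_
  dsimp only
  refine run_seq_sub (run_emit (c := .Q) (k := .C) (a := q) rfl rfl none .k0) ?_
  simp only [Contents.update_get, Contents.set, Contents.get]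
  refine run_seq_sub (run_drop .C _ _) ?_
  simp only [Contents.update_get, Contents.set, Contents.get]
  have hC : (List.replicate q true ++ List.replicate (p + x.length) true).tail =
      List.replicate (p + x.length + q - 1) true := by
    rw [← List.replicate_add, List.tail_replicate, add_comm]
  simp only [hC]
  refine run_seq_sub (run_word .out [false] _ _) ?_
  simp only [Contents.update_get, Contents.set, Contents.get]
  refine run_seq_sub (run_emit (c := .C) (k := .out) (a := p + x.length + q - 1) rfl rfl none
    .k0) ?_
  simp only [Contents.update_get, Contents.set, Contents.get]
  refine run_seq_sub (run_word .out [false, false] _ _) ?_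
  simp only [Contents.update_get, Contents.set, Contents.get]
  refine run_seq_sub (run_pour (a := .Q) (b := .out) _ _ _) ?_
  simp only [Contents.update_get, Contents.set, Contents.get]
  refine run_seq_sub (run_pour (a := .L) (b := .out) _ _ _) ?_
  simp only [Contents.update_get, Contents.set, Contents.get]
  refine run_seq_sub (run_word .out [false] _ _) ?_
  simp only [Contents.update_get, Contents.set, Contents.get]
  refine run_seq_sub (run_pour (a := .P) (b := .out) _ _ _) ?_
  simp only [Contents.update_get, Contents.set, Contents.get]
  refine run_seq_sub (run_word .out [false] _ _) ?_
  simp only [Contents.update_get, Contents.set, Contents.get]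
  refine (run_pour (a := .C) (b := .out) _ _ _).of_eq rfl ?_ ?_
  · simp only [Contents.update_get, Contents.set, Contents.get]
    simp [fromVerifierOut, ← hp0, ← hq0, ← hz, encodeNats]
    rw [List.replicate_add x.length q, List.append_assoc]
  · simp only [Contents.get]
    simp only [List.length_replicate]
    have h1 : x.length * (5 * (p + x.length) + 7) ≤
        (x.length + y.length) * (5 * (2 * (x.length + y.length)) + 7) :=
      Nat.mul_le_mul (by omega) (by omega)
    have h2 : z.length * (4 * z.length + 14) ≤
        (x.length + y.length) * (4 * (x.length + y.length) + 14) :=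
      Nat.mul_le_mul (by omega) (by omega)
    have h3 : p ≤ x.length + y.length := by omega
    have h4 : q ≤ x.length + y.length := by omega
    ring_nf at h1 h2 ⊢
    generalize x.length = a at *
    omega

/-- Removes as many symbols from `D` as there are on `N`. -/
def monus : Program := forEach .N (drop .D)

theorem run_monus (s : Contents) (d : ℕ) (hD : s.D = List.replicate d true) (r : Option Bool)
    (φ : Phase) :
    monus.Run (r, φ) s.get (none, φ) { s with
      N := []
      D := List.replicate (d - s.N.length) true : Contents }.get (2 * s.N.length + 1) := by
  have h := run_forEach (k := .N) (P := drop .D)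
    (fun p l => { s with
      N := l
      D := List.replicate (d - p.length) true : Contents }.get)
    (fun _ => φ) (l₀ := s.N) (t := 1) r (fun _ _ => rfl) (by
      intro p b l hp
      refine ⟨some b, ?_⟩
      rw [Contents.update_get]
      refine (run_drop .D _ _).of_eq rfl ?_ le_rfl
      simp [Contents.update_get, Contents.set, Contents.get, Nat.sub_sub])
  rw [show s.get = { s with D := List.replicate d true : Contents }.get by rw [← hD]]
  exact h.of_eq rfl rfl (by omega)

/-- The program that turns the description `y` of an isometry circuit into one of a verification
circuit. The input `x` is `y` again, with its length on the counter `L`. -/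
def toVerifier : Program :=
  readUnary .N ⨟ readUnary .P ⨟ readUnary .Q ⨟ emit .P .D ⨟ emit .Q .D ⨟ monus ⨟
  emit .P .C ⨟ emit .Q .C ⨟ emit .P .A ⨟ emit .L .A ⨟ emit .D .A ⨟ chain ⨟
  word .out [false] ⨟ emit .A .out ⨟ word .out [false] ⨟ invert ⨟
  clear .C ⨟ emit .P .C ⨟ wipe ⨟ word .out [true, false] ⨟ pour .N .out ⨟ word .out [false] ⨟
  pour .P .out ⨟ clear .C ⨟ clear .A ⨟ clear .Q ⨟ clear .L

/-- The output of `toVerifier`. -/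
def toVerifierOut (x y : List Bool) : List Bool :=
  let n := (splitUnary y).1
  let p := (splitUnary (splitUnary y).2).1
  let q := (splitUnary (splitUnary (splitUnary y).2).2).1
  let d := p + q - n
  encodeNats [p, d + 1] ++ (x.foldl wipeStep (p,
    ((splitUnary (splitUnary (splitUnary y).2).2).2.foldl invStep
      (.k0, [], encodeNats [0, x.length + p] ++
        chainCode (q + p) (d + (x.length + p)) [] d)).2.2)).2

theorem run_toVerifier (x y : List Bool) :
    toVerifier.Run (none, .k0)
      { inp := x, y := y, L := List.replicate x.length true : Contents }.get
      (none, .k0) { out := toVerifierOut x y : Contents }.get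
      (1000 * (x.length + y.length + 1) ^ 2) := by
  obtain ⟨hn, hy⟩ := splitUnary_le y
  obtain ⟨hp, hy'⟩ := splitUnary_le (splitUnary y).2
  obtain ⟨hq, hy''⟩ := splitUnary_le (splitUnary (splitUnary y).2).2
  set n := (splitUnary y).1 with hn0
  set p := (splitUnary (splitUnary y).2).1 with hp0
  set q := (splitUnary (splitUnary (splitUnary y).2).2).1 with hq0
  set z := (splitUnary (splitUnary (splitUnary y).2).2).2 with hz
  set d := p + q - n with hd
  refine run_seq_sub (run_readUnary (k := .N) _ _ _) ?_
  simp only [Contents.update_get, Contents.set, Contents.get,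
    ← hn0]
  refine run_seq_sub (run_readUnary (k := .P) _ _ _) ?_
  simp only [Contents.update_get, Contents.set, Contents.get,
    ← hp0]
  refine run_seq_sub (run_readUnary (k := .Q) _ _ _) ?_
  simp only [Contents.update_get, Contents.set, Contents.get,
    ← hq0, ← hz, List.append_nil]
  refine run_seq_sub (run_emit (c := .P) (k := .D) (a := p) rfl rfl none .k0) ?_
  simp only [Contents.update_get, Contents.set, Contents.get]
  refine run_seq_sub (run_emit (c := .Q) (k := .D) (a := q) rfl rfl none .k0) ?_
  simp only [Contents.update_get, Contents.set, Contents.get,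
    List.append_nil, ← List.replicate_add]
  refine run_seq_sub (run_monus _ (q + p) rfl _ _) ?_
  simp only [List.length_replicate, add_comm q p, ← hd]
  refine run_seq_sub (run_emit (c := .P) (k := .C) (a := p) rfl rfl none .k0) ?_
  simp only [Contents.update_get, Contents.set, Contents.get]
  refine run_seq_sub (run_emit (c := .Q) (k := .C) (a := q) rfl rfl none .k0) ?_
  simp only [Contents.update_get, Contents.set, Contents.get]
  refine run_seq_sub (run_emit (c := .P) (k := .A) (a := p) rfl rfl none .k0) ?_
  simp only [Contents.update_get, Contents.set, Contents.get]
  refine run_seq_sub (run_emit (c := .L) (k := .A) (a := x.length) rfl rfl none .k0) ?_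
  simp only [Contents.update_get, Contents.set, Contents.get]
  refine run_seq_sub (run_emit (c := .D) (k := .A) (a := d) rfl rfl none .k0) ?_
  simp only [Contents.update_get, Contents.set, Contents.get,
    List.append_nil, ← List.replicate_add]
  refine run_seq_sub (run_chain _ (q + p) (d + (x.length + p)) d rfl rfl rfl rfl rfl _ _) ?_
  simp only [Nat.add_sub_cancel_left]
  refine run_seq_sub (run_word .out [false] _ _) ?_
  simp only [Contents.update_get, Contents.set, Contents.get]
  refine run_seq_sub (run_emit (c := .A) (k := .out) (a := x.length + p) rfl rfl none .k0) ?_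
  simp only [Contents.update_get, Contents.set, Contents.get]
  refine run_seq_sub (run_word .out [false] _ _) ?_
  simp only [Contents.update_get, Contents.set, Contents.get]
  refine run_seq_sub (run_invert _ rfl _) ?_
  dsimp only
  refine run_seq_sub (run_clear .C _ _ _) ?_
  simp only [Contents.update_get, Contents.set, Contents.get]
  refine run_seq_sub (run_emit (c := .P) (k := .C) (a := p) rfl rfl none .k0) ?_
  simp only [Contents.update_get, Contents.set, Contents.get,
    List.append_nil]
  refine run_seq_sub (run_wipe _ p rfl rfl _ _) ?_
  dsimp only
  refine run_seq_sub (run_word .out [true, false] _ _) ?_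
  simp only [Contents.update_get, Contents.set, Contents.get]
  refine run_seq_sub (run_pour (a := .N) (b := .out) _ _ _) ?_
  simp only [Contents.update_get, Contents.set, Contents.get]
  refine run_seq_sub (run_word .out [false] _ _) ?_
  simp only [Contents.update_get, Contents.set, Contents.get]
  refine run_seq_sub (run_pour (a := .P) (b := .out) _ _ _) ?_
  simp only [Contents.update_get, Contents.set, Contents.get]
  refine run_seq_sub (run_clear .C _ _ _) ?_
  simp only [Contents.update_get, Contents.set, Contents.get]
  refine run_seq_sub (run_clear .A _ _ _) ?_
  simp only [Contents.update_get, Contents.set, Contents.get]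
  refine run_seq_sub (run_clear .Q _ _ _) ?_
  simp only [Contents.update_get, Contents.set, Contents.get]
  refine (run_clear .L _ _ _).of_eq rfl ?_ ?_
  · simp only [Contents.update_get, Contents.set]
    simp [toVerifierOut, ← hp0, ← hq0, ← hz, ← hn0, ← hd, encodeNats]
    rw [List.replicate_succ', List.append_assoc]
    rfl
  · simp only [Contents.get]
    simp only [List.length_replicate]
    have h1 : x.length * (5 * (p + x.length) + 7) ≤
        (x.length + y.length) * (5 * (2 * (x.length + y.length)) + 7) :=
      Nat.mul_le_mul (by omega) (by omega)
    have h2 : z.length * (4 * z.length + 14) ≤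
        (x.length + y.length) * (4 * (x.length + y.length) + 14) :=
      Nat.mul_le_mul (by omega) (by omega)
    have h3 : d * (10 * (d + (x.length + p)) + 10 * (q + p) + 17) ≤
        2 * (x.length + y.length) * (60 * (x.length + y.length) + 17) :=
      Nat.mul_le_mul (by omega) (by omega)
    ring_nf at h1 h2 h3 ⊢
    omega

end Program

end Passes

end QuantumProofs

namespace QuantumProofs
open Turing Function

/-! ### Programs applied to the output of a machine -/

section Combined

open Fragment

/-- The program that saves the input, runs the machine `tm` on it and then runs `G` on the input and
the output of `tm`. -/
def combined (tm : FinTM2) (e₀ : tm.Γ tm.k₀ ≃ Bool) (e₁ : tm.Γ tm.k₁ ≃ Bool) (G : Program) :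
    Fragment (tm.K ⊕ Stk) (Sum.elim tm.Γ fun _ => Bool) (tm.σ × Reg) :=
  (Program.pour .inp .tmp).right _ _ ⨟
  popLoop (.inr .tmp) (fun v o => (v.1, o, v.2.2)) (fun v => v.2.1.isSome)
    (single (.push (.inr .inp) (fun v => v.2.1.getD false) (.push (.inr .L) (fun _ => true)
      (.push (.inl tm.k₀) (fun v => e₀.symm (v.2.1.getD false)) (.goto fun _ => none))))) ⨟
  (ofMachine tm).left _ _ ⨟
  popLoop (.inl tm.k₁) (fun v o => (v.1, o.map e₁, v.2.2)) (fun v => v.2.1.isSome)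
    (single (.push (.inr .tmp) (fun v => v.2.1.getD false) (.goto fun _ => none))) ⨟
  (Program.pour .tmp .y).right _ _ ⨟
  G.right _ _

section

variable {K₁ K₂ : Type} {Γ₁ : K₁ → Type} {Γ₂ : K₂ → Type} {σ L : Type} [DecidableEq K₁]
  [DecidableEq K₂]

theorem stepAux_push_inl (k : K₁) (f : σ → Γ₁ k) (q : TM2.Stmt (Sum.elim Γ₁ Γ₂) L σ) (v : σ)
    (S₁ : ∀ k, List (Γ₁ k)) (S₂ : ∀ k, List (Γ₂ k)) :
    TM2.stepAux (.push (.inl k) f q) v (joinStk S₁ S₂) =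
      TM2.stepAux q v (joinStk (update S₁ k (f v :: S₁ k)) S₂) :=
  congrArg _ (update_joinStk_inl ..)

theorem stepAux_push_inr (k : K₂) (f : σ → Γ₂ k) (q : TM2.Stmt (Sum.elim Γ₁ Γ₂) L σ) (v : σ)
    (S₁ : ∀ k, List (Γ₁ k)) (S₂ : ∀ k, List (Γ₂ k)) :
    TM2.stepAux (.push (.inr k) f q) v (joinStk S₁ S₂) =
      TM2.stepAux q v (joinStk S₁ (update S₂ k (f v :: S₂ k))) :=
  congrArg _ (update_joinStk_inr ..)

end

theorem update_onlyStk {K : Type} {Γ : K → Type} [DecidableEq K] (k : K) (s s' : List (Γ k)) :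
    update (onlyStk k s) k s' = onlyStk k s' :=
  update_idem ..

theorem onlyStk_self {K : Type} {Γ : K → Type} [DecidableEq K] (k : K) (s : List (Γ k)) :
    onlyStk k s k = s :=
  update_self ..

theorem onlyStk_nil {K : Type} {Γ : K → Type} [DecidableEq K] (k : K) :
    onlyStk (Γ := Γ) k [] = fun _ => [] :=
  update_eq_self k _

theorem onlyStk_inr {K₁ K₂ : Type} {Γ₁ : K₁ → Type} {Γ₂ : K₂ → Type} [DecidableEq K₁]
    [DecidableEq K₂] (k : K₂) (s : List (Γ₂ k)) :
    onlyStk (K := K₁ ⊕ K₂) (Γ := Sum.elim Γ₁ Γ₂) (.inr k) s =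
      joinStk (fun _ => []) (onlyStk k s) := by
  unfold onlyStk
  rw [← update_joinStk_inr]
  congr 1
  funext j
  cases j <;> rfl

theorem run_combined (tm : FinTM2) (e₀ : tm.Γ tm.k₀ ≃ Bool) (e₁ : tm.Γ tm.k₁ ≃ Bool) (G : Program)
    {x y z : List Bool} {t t' : ℕ}
    (hf : (ofMachine tm).Run tm.initialState (onlyStk tm.k₀ (x.map e₀.symm)) tm.initialState
      (onlyStk tm.k₁ (y.map e₁.symm)) t)
    (hG : G.Run (none, .k0) { inp := x, y := y, L := List.replicate x.length true : Contents }.get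
      (none, .k0) { out := z : Contents }.get t') :
    (combined tm e₀ e₁ G).Run (tm.initialState, none, .k0)
      (joinStk (fun _ => []) { inp := x : Contents }.get) (tm.initialState, none, .k0)
      (joinStk (fun _ => []) { out := z : Contents }.get)
      (4 * x.length + 4 * y.length + t + t' + 4) := by
  have hA := run_right (Program.run_pour (a := .inp) (b := .tmp) none .k0
    { inp := x : Contents }.get) tm.initialState (fun k => ([] : List (tm.Γ k)))
  have hB := run_popLoop (K := tm.K ⊕ Stk) (Γ := Sum.elim tm.Γ fun _ => Bool) (k := .inr .tmp)
    (set := fun (v : tm.σ × Reg) o => (v.1, o, v.2.2)) (test := fun v => v.2.1.isSome)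
    (P := single (.push (.inr .inp) (fun v => v.2.1.getD false) (.push (.inr .L) (fun _ => true)
      (.push (.inl tm.k₀) (fun v => e₀.symm (v.2.1.getD false)) (.goto fun _ => none)))))
    (fun (p l : List Bool) => joinStk (onlyStk tm.k₀ (p.reverse.map e₀.symm))
      { inp := p.reverse, tmp := l, L := List.replicate p.length true : Contents }.get)
    (fun _ => (tm.initialState, none, .k0)) (l₀ := x.reverse) (t := 1) (fun _ _ => rfl)
    (fun _ _ => rfl) (fun _ => rfl) (fun (p : List Bool) (b : Bool) (l : List Bool) _ =>
      ⟨(tm.initialState, some b, .k0), rfl, by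
      refine run_single ((congrArg _ (update_joinStk_inr ..)).trans ?_)
      refine (stepAux_push_inr (Γ₁ := tm.Γ) (Γ₂ := fun _ : Stk => Bool) (L := Option Unit)
        Stk.inp (fun v : tm.σ × Reg => v.2.1.getD false) _ _ _ _).trans ?_
      refine (stepAux_push_inr (Γ₁ := tm.Γ) (Γ₂ := fun _ : Stk => Bool) (L := Option Unit)
        Stk.L (fun _ : tm.σ × Reg => true) _ _ _ _).trans ?_
      refine (stepAux_push_inl (Γ₁ := tm.Γ) (Γ₂ := fun _ : Stk => Bool) (L := Option Unit)
        tm.k₀ (fun v : tm.σ × Reg => e₀.symm (v.2.1.getD false)) _ _ _ _).trans ?_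
      refine congrArg₂ (fun A B => (⟨some none, (tm.initialState, some b, Phase.k0), joinStk A B⟩ :
        TM2.Cfg (Sum.elim tm.Γ fun _ => Bool) (Option Unit) (tm.σ × Reg))) ?_ ?_
      · simp only [update_onlyStk, onlyStk_self]
        exact congrArg (onlyStk tm.k₀) (by simp : e₀.symm b :: p.reverse.map e₀.symm =
          (p ++ [b]).reverse.map e₀.symm)
      · simp only [Contents.update_get, Contents.set, Contents.get]
        exact congrArg Contents.get (by simp [List.replicate_succ] :
          ({ inp := b :: p.reverse, tmp := l, L := true :: List.replicate p.length true } :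
            Contents) =
          { inp := (p ++ [b]).reverse, tmp := l, L := List.replicate (p ++ [b]).length true })⟩)
  have hM := run_left hf (σ₂ := Reg) (Γ₂ := fun _ => Bool) (none, .k0)
    { inp := x, L := List.replicate x.length true : Contents }.get
  have hD := run_popLoop (K := tm.K ⊕ Stk) (Γ := Sum.elim tm.Γ fun _ => Bool) (k := .inl tm.k₁)
    (set := fun (v : tm.σ × Reg) o => (v.1, o.map e₁, v.2.2)) (test := fun v => v.2.1.isSome)
    (P := single (.push (.inr .tmp) (fun v => v.2.1.getD false) (.goto fun _ => none)))
    (fun (p l : List (tm.Γ tm.k₁)) => joinStk (onlyStk tm.k₁ l)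
      { inp := x, tmp := (p.map e₁).reverse, L := List.replicate x.length true : Contents }.get)
    (fun _ => (tm.initialState, none, .k0)) (l₀ := y.map e₁.symm) (t := 1)
    (fun _ l => onlyStk_self tm.k₁ l)
    (fun _ _ => rfl) (fun _ => rfl)
    (fun (p : List (tm.Γ tm.k₁)) (b : tm.Γ tm.k₁) (l : List (tm.Γ tm.k₁)) _ =>
      ⟨(tm.initialState, some (e₁ b), .k0), rfl, by
      refine run_single ((congrArg _ (update_joinStk_inl ..)).trans ?_)
      refine (stepAux_push_inr (Γ₁ := tm.Γ) (Γ₂ := fun _ : Stk => Bool) (L := Option Unit)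
        Stk.tmp (fun v : tm.σ × Reg => v.2.1.getD false) _ _ _ _).trans ?_
      refine congrArg₂ (fun A B =>
        (⟨some none, (tm.initialState, some (e₁ b), Phase.k0), joinStk A B⟩ :
          TM2.Cfg (Sum.elim tm.Γ fun _ => Bool) (Option Unit) (tm.σ × Reg))) ?_ ?_
      · exact update_onlyStk ..
      · simp only [Contents.update_get, Contents.set, Contents.get]
        exact congrArg Contents.get (by simp :
          ({ inp := x, tmp := e₁ b :: (p.map e₁).reverse, L := List.replicate x.length true } :
            Contents) =
          { inp := x, tmp := ((p ++ [b]).map e₁).reverse, L := List.replicate x.length true })⟩)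
  have hB := hB.of_eq (w := (tm.initialState, none, .k0))
    (T := joinStk (onlyStk tm.k₀ (x.map e₀.symm))
      { inp := x, L := List.replicate x.length true : Contents }.get) rfl
    (congrArg₂ joinStk (by simp) (by simp))
    (t' := 2 * x.length + 1) (by simp; omega)
  have hD := hD.of_eq (w := (tm.initialState, none, .k0)) (T := joinStk (fun k => [])
    { inp := x, tmp := y.reverse, L := List.replicate x.length true : Contents }.get) rfl
    (congrArg₂ joinStk (onlyStk_nil _) (by simp)) (t' := 2 * y.length + 1) (by simp; omega)
  have hE := run_right (Program.run_pour (a := .tmp) (b := .y) none .k0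
    { inp := x, tmp := y.reverse, L := List.replicate x.length true : Contents }.get)
    tm.initialState (fun k => ([] : List (tm.Γ k)))
  have hF := run_right hG tm.initialState (fun k => ([] : List (tm.Γ k)))
  simp only [Contents.update_get, Contents.set, Contents.get, List.append_nil, List.reverse_reverse,
    List.length_reverse] at hA hE
  have h := run_seq (hA.of_eq rfl
    (congrArg₂ joinStk (onlyStk_nil tm.k₀).symm rfl) le_rfl)
    (run_seq hB (run_seq hM (run_seq hD (run_seq hE hF))))
  exact h.mono (by omega)

theorem onlyStk_inr_map_refl {K₁ : Type} {Γ₁ : K₁ → Type} [DecidableEq K₁] (k : Stk)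
    (l : List Bool) :
    onlyStk (K := K₁ ⊕ Stk) (Γ := Sum.elim Γ₁ fun _ => Bool) (.inr k)
      (l.map (Equiv.refl Bool).symm) = joinStk (fun _ => []) (Contents.set {} k l).get := by
  have h : onlyStk (Γ := fun _ : Stk => Bool) k l = (Contents.set {} k l).get := by
    rw [← Contents.update_get]
    unfold onlyStk
    congr 1
    funext j
    cases j <;> rfl
  exact (onlyStk_inr (Γ₁ := Γ₁) (Γ₂ := fun _ => Bool) k _).trans
    (congrArg _ ((congrArg (onlyStk (Γ := fun _ : Stk => Bool) k) (List.map_id l)).trans h))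

/-- If `f` is computable in polynomial time and `g x y` is computed by a program in polynomial time,
then `x ↦ g x (f x)` is computable in polynomial time. -/
theorem IsPolyTime.comp_program {f : List Bool → List Bool} (hf : IsPolyTime f) (G : Program)
    {g : List Bool → List Bool → List Bool} {c : ℕ}
    (hG : ∀ x y, G.Run (none, .k0)
      { inp := x, y := y, L := List.replicate x.length true : Contents }.get
      (none, .k0) { out := g x y : Contents }.get (c * (x.length + y.length + 1) ^ 2)) :
    IsPolyTime fun x => g x (f x) := by
  obtain ⟨⟨⟨tm, e₀, e₁⟩, p, hp⟩⟩ := hf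
  let _ := tm.kFin
  let _ := tm.σFin
  obtain ⟨d, hd⟩ := (ofMachine tm).length_le_of_run
  have hrun : ∀ x, (ofMachine tm).Run tm.initialState (onlyStk tm.k₀ (x.map e₀.symm))
      tm.initialState (onlyStk tm.k₁ ((f x).map e₁.symm)) (p.eval x.length) := fun x => by
    obtain ⟨⟨n, hn⟩, hle⟩ := hp x
    refine ⟨n, hle, reach_ofMachine tm ?_⟩
    rw [initList_eq] at hn
    exact hn.trans (congrArg some (haltList_eq tm _))
  have hlen : ∀ x, (f x).length ≤ x.length + d * p.eval x.length := fun x => by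
    have h := hd _ _ _ _ _ (hrun x) tm.k₁
    rw [onlyStk_self, List.length_map] at h
    refine h.trans (Nat.add_le_add_right ?_ _)
    by_cases hk : tm.k₁ = tm.k₀
    · rw [hk, onlyStk_self, List.length_map]
    · rw [onlyStk, update_of_ne hk]
      exact Nat.zero_le _
  set r : Polynomial ℕ := .X + .C d * p with hr
  refine isPolyTime_of_run (combined tm e₀ e₁ G) (k₀ := .inr .inp) (k₁ := .inr .out)
    (Equiv.refl Bool) (Equiv.refl Bool) (tm.initialState, none, .k0)
    (4 * .X + 4 * r + p + .C c * (.X + r + 1) ^ 2 + 4) fun x => ?_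
  have h := run_combined tm e₀ e₁ G (hrun x) (hG x (f x))
  have hl : (f x).length ≤ r.eval x.length := by simpa [hr] using hlen x
  have hS : ∀ S S', S = joinStk (fun _ => []) { inp := x : Contents }.get →
      S' = joinStk (fun _ => []) { out := g x (f x) : Contents }.get →
      (combined tm e₀ e₁ G).Run (tm.initialState, none, .k0) S (tm.initialState, none, .k0) S'
        (4 * x.length + 4 * (f x).length + p.eval x.length +
          c * (x.length + (f x).length + 1) ^ 2 + 4) := by
    rintro _ _ rfl rfl
    exact h
  refine (hS _ _ (onlyStk_inr_map_refl ..) (onlyStk_inr_map_refl ..)).mono ?_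
  simp only [Polynomial.eval_add, Polynomial.eval_mul, Polynomial.eval_pow, Polynomial.eval_X,
    Polynomial.eval_C, Polynomial.eval_one, Polynomial.eval_ofNat]
  gcongr

end Combined

end QuantumProofs

namespace QuantumProofs

/-! ### The circuits that the programs write -/

section Circuits

/-- The inverse gate. -/
def Gate.inv {N : ℕ} : Gate N → Gate N
  | .X t => .X t
  | .H t => .H t
  | .T t => .Tinv t
  | .Tinv t => .T t
  | .CNOT a t h => .CNOT a t h
  | .Toffoli a b t h₁ h₂ h₃ => .Toffoli a b t h₁ h₂ h₃

/-- The inverse circuit. -/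
def invCircuit {N : ℕ} (gs : List (Gate N)) : List (Gate N) := gs.reverse.map Gate.inv

/-- A gate as a gate on a larger register that extends the given one at the end. -/
def Gate.castLE {N M : ℕ} (h : N ≤ M) : Gate N → Gate M
  | .X t => .X (t.castLE h)
  | .H t => .H (t.castLE h)
  | .T t => .T (t.castLE h)
  | .Tinv t => .Tinv (t.castLE h)
  | .CNOT a t hat => .CNOT (a.castLE h) (t.castLE h) (by simpa using hat)
  | .Toffoli a b t hab hat hbt => .Toffoli (a.castLE h) (b.castLE h) (t.castLE h)
      (by simpa using hab) (by simpa using hat) (by simpa using hbt)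

theorem Gate.code_castLE {N M : ℕ} (h : N ≤ M) (g : Gate N) : (g.castLE h).code = g.code := by
  cases g <;> rfl

/-- The circuit that consists of an `X` gate on wire `w`; it is empty if there is no such wire. -/
def xCircuit (N w : ℕ) : List (Gate N) := if h : w < N then [.X ⟨w, h⟩] else []

/-- The circuit that consists of a Toffoli gate on the given wires; it is empty if they are not
suitable. -/
def toffoliCircuit (N a b t : ℕ) : List (Gate N) :=
  if h : (a < N ∧ b < N ∧ t < N) ∧ a ≠ b ∧ a ≠ t ∧ b ≠ t then
    [.Toffoli ⟨a, h.1.1⟩ ⟨b, h.1.2.1⟩ ⟨t, h.1.2.2⟩ (by simpa using h.2.1) (by simpa using h.2.2.1)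
      (by simpa using h.2.2.2)]
  else []

/-- The circuit that applies `X` to those wires, from wire `c` on, where the bit string is `1`. -/
def wipeCircuit (N : ℕ) : ℕ → List Bool → List (Gate N)
  | _, [] => []
  | c, b :: l => wipeCircuit N (c + 1) l ++ if b then xCircuit N c else []

/-- The circuit that adds to wire `a` the conjunction of wire `a - k` and the negations of the wires
`c - k, …, c - 1`, if the wires `a - k + 1, …, a - 1` are `0` initially. -/
def chainCircuit (N c a : ℕ) : ℕ → List (Gate N)
  | 0 => []
  | k + 1 => xCircuit N (c - k - 1) ++ toffoliCircuit N (a - k - 1) (c - k - 1) (a - k) ++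
      chainCircuit N c a k

theorem code_xCircuit {N w : ℕ} (h : w < N) : (xCircuit N w).flatMap Gate.code = [0, w] := by
  simp [xCircuit, h, Gate.code]

theorem encodeNats_append (l l' : List ℕ) : encodeNats (l ++ l') = encodeNats l ++ encodeNats l' :=
  List.flatMap_append

theorem wipe_foldl {N : ℕ} (x : List Bool) (c : ℕ) (h : c + x.length ≤ N) (w : List ℕ) :
    (x.foldl wipeStep (c, encodeNats w)).2 =
      encodeNats ((wipeCircuit N c x).flatMap Gate.code ++ w) := by
  induction x generalizing c w with
  | nil => rfl
  | cons b x ih =>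
    simp only [List.length_cons] at h
    cases b
    · simpa [wipeCircuit, wipeStep] using ih (c + 1) (by omega) w
    · have := ih (c + 1) (by omega) ([0, c] ++ w)
      rw [encodeNats_append] at this
      simp only [List.foldl_cons, wipeStep, if_true, this, wipeCircuit, List.flatMap_append,
        code_xCircuit (show c < N by omega), List.append_assoc]

theorem inv_foldl_true (a : ℕ) (buf o : List Bool) :
    (List.replicate a true).foldl invStep (.a1, buf, o) = (.a1, List.replicate a true ++ buf, o) ∧
    (List.replicate a true).foldl invStep (.a2, buf, o) = (.a2, List.replicate a true ++ buf, o) ∧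
    (List.replicate a true).foldl invStep (.a3, buf, o) =
      (.a3, List.replicate a true ++ buf, o) := by
  induction a generalizing buf with
  | zero => simp
  | succ a ih =>
    have h : ∀ l : List Bool,
        List.replicate a true ++ true :: l = List.replicate (a + 1) true ++ l := fun l => by
      rw [List.replicate_succ', List.append_assoc]
      rfl
    simp [List.replicate_succ, invStep, Phase.next, Phase.buffer, ih, h]

/-- The inversion pass reads the code of a gate and puts the code of the inverse gate in front of
the output. -/
theorem inv_foldl_gate {N : ℕ} (g : Gate N) (o : List Bool) :
    (encodeNats g.code).foldl invStep (.k0, [], o) = (.k0, [], encodeNats g.inv.code ++ o) := by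
  have h1 := fun a buf o => (inv_foldl_true a buf o).1
  have h2 := fun a buf o => (inv_foldl_true a buf o).2.1
  have h3 := fun a buf o => (inv_foldl_true a buf o).2.2
  cases g <;>
    simp [Gate.code, Gate.inv, encodeNats, List.foldl_append, invStep, Phase.next, Phase.buffer,
      List.replicate_succ, h1, h2, h3]

theorem inv_foldl {N : ℕ} (gs : List (Gate N)) (w : List ℕ) :
    (encodeNats (gs.flatMap Gate.code)).foldl invStep (.k0, [], encodeNats w) =
      (.k0, [], encodeNats ((invCircuit gs).flatMap Gate.code ++ w)) := by
  induction gs generalizing w with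
  | nil => rfl
  | cons g gs ih =>
    rw [List.flatMap_cons, encodeNats_append, List.foldl_append, inv_foldl_gate,
      ← encodeNats_append, ih]
    simp [invCircuit]

theorem chainCode_eq {N c a k : ℕ} (hk : k ≤ c) (hc : c < a) (ha : a < N) :
    chainCode c a [] k = encodeNats ((chainCircuit N c a k).flatMap Gate.code) := by
  induction k with
  | zero => rfl
  | succ k ih =>
    rw [chainCode, ih (by omega), ← encodeNats_append]
    have h : ((a - k - 1 < N ∧ c - k - 1 < N ∧ a - k < N) ∧
      a - k - 1 ≠ c - k - 1 ∧ a - k - 1 ≠ a - k ∧ c - k - 1 ≠ a - k) := by omega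
    rw [chainCircuit, List.flatMap_append, List.flatMap_append, code_xCircuit (by omega),
      toffoliCircuit, dif_pos h]
    simp [Gate.code]

/-- The isometry whose output has a large fidelity with `σ ⊗ |0 ⋯ 0⟩⟨0 ⋯ 0|` if the verification
circuit accepts `σ`: it undoes the verification, starting from an accepting answer. -/
def Verifier.toIsometry (x : List Bool) (V : Verifier x.length) : IsometryCircuit where
  n := V.proofQubits + (x.length + V.scratchQubits) - 1
  m₁ := V.proofQubits
  m₂ := x.length + V.scratchQubits
  le := Nat.sub_le _ _
  gates := xCircuit _ (V.proofQubits + (x.length + V.scratchQubits) - 1) ++ invCircuit V.gates ++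
    wipeCircuit _ V.proofQubits x

theorem fromVerifierOut_encode (x : List Bool) (V : Verifier x.length) :
    Program.fromVerifierOut x V.encode = (V.toIsometry x).encode := by
  have hpos := V.pos
  rw [Program.fromVerifierOut, Verifier.encode, splitUnary_encodeNats, splitUnary_encodeNats]
  dsimp only
  rw [show ([] : List Bool) = encodeNats [] from rfl, wipe_foldl (N := V.proofQubits +
    (x.length + V.scratchQubits)) x V.proofQubits (by omega) []]
  rw [show encodeNats [] = ([] : List Bool) from rfl, inv_foldl, ← encodeNats_append]
  rw [IsometryCircuit.encode]
  simp only [Verifier.toIsometry, List.flatMap_append]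
  rw [code_xCircuit (by omega)]
  simp [add_assoc]

/-- Numbers are written in unary, so an input register that holds the description of the circuit has
room for the qubits that the circuit acts on. -/
theorem IsometryCircuit.add_le_length_encode (C : IsometryCircuit) :
    C.n + C.m₁ + C.m₂ < C.encode.length := by
  simp [IsometryCircuit.encode, encodeNats]
  omega

/-- The verification circuit that clears the input register, applies the inverse of the isometry
circuit to the proof, padded with zeros, and checks that the qubits from qubit `n` on are `0`. -/
def IsometryCircuit.toVerifier (C : IsometryCircuit) (x : List Bool) (h : C.m₂ ≤ x.length) :
    Verifier x.length where
  proofQubits := C.m₁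
  scratchQubits := C.m₁ + C.m₂ - C.n + 1
  pos := by omega
  gates := wipeCircuit _ C.m₁ x ++ (invCircuit C.gates).map (Gate.castLE (by omega)) ++
    (xCircuit _ (x.length + C.m₁) ++ chainCircuit _ (C.m₂ + C.m₁)
      (C.m₁ + C.m₂ - C.n + (x.length + C.m₁)) (C.m₁ + C.m₂ - C.n))

theorem toVerifierOut_encode (C : IsometryCircuit) (x : List Bool) (h : C.m₂ < x.length) :
    Program.toVerifierOut x C.encode = (C.toVerifier x h.le).encode := by
  rw [Program.toVerifierOut, IsometryCircuit.encode]
  simp only [splitUnary_encodeNats]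
  rw [chainCode_eq (N := C.m₁ + (x.length + (C.m₁ + C.m₂ - C.n + 1))) (by omega) (by omega)
    (by omega), ← encodeNats_append, inv_foldl,
    wipe_foldl (N := C.m₁ + (x.length + (C.m₁ + C.m₂ - C.n + 1))) x C.m₁ (by omega),
    ← encodeNats_append, Verifier.encode]
  simp only [IsometryCircuit.toVerifier, List.flatMap_append, List.flatMap_map, Gate.code_castLE]
  rw [code_xCircuit (by omega)]
  simp

end Circuits

end QuantumProofs

namespace QuantumProofs
open Function Matrix

/-! ### Circuits are unitary -/

section Unitarity

variable {N : ℕ}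

/-- A sum over bit strings whose terms vanish unless the string agrees with `j` off position `t`. -/
theorem sum_eq_sum_update (f : (Fin N → Bool) → ℂ) (j : Fin N → Bool) (t : Fin N)
    (hf : ∀ m, (∃ k, k ≠ t ∧ m k ≠ j k) → f m = 0) : ∑ m, f m = ∑ b, f (update j t b) := by
  refine (Fintype.sum_of_injective (update j t) (update_injective j t) _ _ (fun m hm => ?_)
    fun _ => rfl).symm
  refine hf m ?_
  by_contra! h
  exact hm ⟨m t, by rw [update_eq_iff]; exact ⟨rfl, fun k hk => (h k hk).symm⟩⟩

theorem controlled_mul {cs : Finset (Fin N)} {t : Fin N} (ht : t ∉ cs) (u v : Matrix Bool Bool ℂ) :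
    controlled cs t u * controlled cs t v = controlled cs t (u * v) := by
  ext i j
  rw [mul_apply, sum_eq_sum_update _ j t]
  · have h1 : ∀ b, (∀ k, k ≠ t → i k = update j t b k) ↔ ∀ k, k ≠ t → i k = j k := fun b =>
      forall₂_congr fun k hk => by rw [update_of_ne hk]
    have h2 : ∀ b, (∀ k, k ≠ t → update j t b k = j k) := fun b k hk => update_of_ne hk ..
    have h3 : ∀ b, (∀ k ∈ cs, update j t b k = true) ↔ ∀ k ∈ cs, j k = true := fun b =>
      forall₂_congr fun k hk => by rw [update_of_ne (show k ≠ t by rintro rfl; exact ht hk)]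
    simp only [controlled, h1, h3, if_pos (h2 _), update_self]
    by_cases hi : ∀ k, k ≠ t → i k = j k
    · by_cases hj : ∀ k ∈ cs, j k = true
      · simp [if_pos hi, if_pos hj, mul_apply]
      · simp [if_pos hi, if_neg hj]
    · simp [if_neg hi]
  · rintro m ⟨k, hk, hm⟩
    have : ¬ ∀ k, k ≠ t → m k = j k := fun h => hm (h k hk)
    simp [controlled, this]

theorem controlled_one (cs : Finset (Fin N)) (t : Fin N) : controlled cs t 1 = 1 := by
  ext i j
  have h : (i = j) ↔ (∀ k, k ≠ t → i k = j k) ∧ i t = j t := by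
    refine ⟨fun h => by simp [h], fun ⟨h1, h2⟩ => funext fun k => ?_⟩
    by_cases hk : k = t
    · exact hk ▸ h2
    · exact h1 k hk
  simp only [controlled, one_apply, h]
  split_ifs <;> simp_all

theorem controlled_conjTranspose {cs : Finset (Fin N)} {t : Fin N} (ht : t ∉ cs)
    (u : Matrix Bool Bool ℂ) : (controlled cs t u)ᴴ = controlled cs t uᴴ := by
  ext i j
  simp only [conjTranspose_apply, controlled, @eq_comm _ (j _) (i _)]
  by_cases h : ∀ k, k ≠ t → i k = j k
  · have h3 : (∀ k ∈ cs, i k = true) ↔ ∀ k ∈ cs, j k = true :=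
      forall₂_congr fun k hk => by rw [h k (fun h => ht (h ▸ hk))]
    simp only [if_pos h, h3]
    split_ifs <;> simp
  · simp [if_neg h]

theorem pauliX_mul_self : pauliX * pauliX = 1 := by
  ext a b
  cases a <;> cases b <;> simp [pauliX, mul_apply]

theorem pauliX_conjTranspose : pauliXᴴ = pauliX := by
  ext a b
  cases a <;> cases b <;> simp [pauliX]

theorem hadamard_mul_self : hadamard * hadamard = 1 := by
  have h : ((Real.sqrt 2 : ℝ) : ℂ) * (Real.sqrt 2 : ℝ) = 2 := by
    rw [← Complex.ofReal_mul, Real.mul_self_sqrt (by norm_num)]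
    norm_num
  ext a b
  cases a <;> cases b <;>
    (simp [hadamard, mul_apply, div_mul_div_comm, ← mul_inv, h, neg_div]; try norm_num)

theorem hadamard_conjTranspose : hadamardᴴ = hadamard := by
  ext a b
  cases a <;> cases b <;> simp [hadamard]

theorem phase_mul_phase_neg (θ : ℝ) : phase θ * phase (-θ) = 1 := by
  rw [phase, phase, diagonal_mul_diagonal, ← diagonal_one]
  congr 1
  funext a
  cases a <;> simp [← Complex.exp_add]

theorem phase_conjTranspose (θ : ℝ) : (phase θ)ᴴ = phase (-θ) := by
  rw [phase, phase, diagonal_conjTranspose]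
  congr 1
  funext a
  cases a <;> simp [← Complex.exp_conj]

theorem Gate.matrix_inv (g : Gate N) : g.inv.matrix = g.matrixᴴ := by
  cases g <;> simp [Gate.matrix, Gate.inv] <;> rw [controlled_conjTranspose]
  all_goals first
    | rw [pauliX_conjTranspose]
    | rw [hadamard_conjTranspose]
    | rw [phase_conjTranspose, neg_neg]
    | rw [phase_conjTranspose]
    | simp_all [eq_comm]

theorem Gate.matrix_mul_conjTranspose (g : Gate N) : g.matrix * g.matrixᴴ = 1 := by
  cases g <;> simp [Gate.matrix] <;> rw [controlled_conjTranspose, controlled_mul]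
  all_goals first
    | rw [pauliX_conjTranspose, pauliX_mul_self, controlled_one]
    | rw [hadamard_conjTranspose, hadamard_mul_self, controlled_one]
    | rw [phase_conjTranspose, phase_mul_phase_neg, controlled_one]
    | simp_all [eq_comm]

theorem circuitMatrix_append (gs gs' : List (Gate N)) :
    circuitMatrix (gs ++ gs') = circuitMatrix gs' * circuitMatrix gs := by
  induction gs with
  | nil => simp [circuitMatrix]
  | cons g gs ih => simp [circuitMatrix, ih, Matrix.mul_assoc]

theorem circuitMatrix_invCircuit (gs : List (Gate N)) :
    circuitMatrix (invCircuit gs) = (circuitMatrix gs)ᴴ := by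
  induction gs with
  | nil => simp [circuitMatrix, invCircuit]
  | cons g gs ih =>
    have h : invCircuit (g :: gs) = invCircuit gs ++ [g.inv] := by simp [invCircuit]
    rw [h, circuitMatrix_append, ih]
    simp [circuitMatrix, Gate.matrix_inv]

theorem circuitMatrix_mul_conjTranspose (gs : List (Gate N)) :
    circuitMatrix gs * (circuitMatrix gs)ᴴ = 1 := by
  induction gs with
  | nil => simp [circuitMatrix]
  | cons g gs ih =>
    rw [circuitMatrix, conjTranspose_mul, Matrix.mul_assoc, ← Matrix.mul_assoc g.matrix,
      g.matrix_mul_conjTranspose, Matrix.one_mul, ih]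

theorem circuitMatrix_conjTranspose_mul (gs : List (Gate N)) :
    (circuitMatrix gs)ᴴ * circuitMatrix gs = 1 :=
  mul_eq_one_comm.mp (circuitMatrix_mul_conjTranspose gs)

end Unitarity

/-! ### Operators on a part of a register -/

section Extension

variable {n N : ℕ}

/-- The string that agrees with `a` on the first `n` positions and with `i` on the others. -/
def glue (i : Fin N → Bool) (a : Fin n → Bool) : Fin N → Bool :=
  fun k => if h : k.val < n then a ⟨k, h⟩ else i k

/-- The first `n` bits of a string. -/
def restrict (h : n ≤ N) (i : Fin N → Bool) : Fin n → Bool := fun k => i (k.castLE h)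

theorem restrict_glue (h : n ≤ N) (i : Fin N → Bool) (a : Fin n → Bool) :
    restrict h (glue i a) = a := by
  funext k
  simp [restrict, glue]

theorem glue_of_le (i : Fin N → Bool) (a : Fin n → Bool) {k : Fin N} (hk : n ≤ k.val) :
    glue i a k = i k := dif_neg (not_lt.mpr hk)

theorem glue_injective (h : n ≤ N) (i : Fin N → Bool) :
    Injective (glue i : (Fin n → Bool) → _) :=
  LeftInverse.injective (restrict_glue h i)

theorem glue_restrict (h : n ≤ N) {i m : Fin N → Bool} (hm : ∀ k : Fin N, n ≤ k.val → m k = i k) :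
    glue i (restrict h m) = m := by
  funext k
  by_cases hk : k.val < n
  · simp [glue, hk, restrict]
  · rw [glue_of_le _ _ (not_lt.mp hk), hm k (not_lt.mp hk)]

/-- A sum over bit strings whose terms vanish unless the string agrees with `i` from position `n`
on. -/
theorem sum_eq_sum_glue {M : Type*} [AddCommMonoid M] (h : n ≤ N) (f : (Fin N → Bool) → M)
    (i : Fin N → Bool) (hf : ∀ m, ¬ (∀ k : Fin N, n ≤ k.val → m k = i k) → f m = 0) :
    ∑ m, f m = ∑ a : Fin n → Bool, f (glue i a) := by
  refine (Fintype.sum_of_injective (glue i) (glue_injective h i) _ _ (fun m hm => ?_)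
    fun _ => rfl).symm
  exact hf m fun hk => hm ⟨_, glue_restrict h hk⟩

/-- The operator `A ⊗ 1` on `N` qubits, for an operator `A` on the first `n` qubits. -/
def extend (h : n ≤ N) (A : QMatrix n) : QMatrix N := fun i j =>
  if ∀ k : Fin N, n ≤ k.val → i k = j k then A (restrict h i) (restrict h j) else 0

theorem extend_mul_apply (h : n ≤ N) (A : QMatrix n) (M : QMatrix N) (i j : Fin N → Bool) :
    (extend h A * M) i j = ∑ a, A (restrict h i) a * M (glue i a) j := by
  rw [mul_apply, sum_eq_sum_glue h _ i]
  · refine Finset.sum_congr rfl fun a _ => ?_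
    rw [extend, if_pos fun k hk => (glue_of_le i a hk).symm, restrict_glue]
  · intro m hm
    rw [extend, if_neg fun hk => hm fun k hn => (hk k hn).symm, zero_mul]

theorem extend_conjTranspose (h : n ≤ N) (A : QMatrix n) : (extend h A)ᴴ = extend h Aᴴ := by
  ext i j
  simp only [conjTranspose_apply, extend, @eq_comm _ (j _) (i _)]
  split_ifs <;> simp

theorem extend_mul (h : n ≤ N) (A B : QMatrix n) :
    extend h A * extend h B = extend h (A * B) := by
  ext i j
  rw [extend_mul_apply]
  have h1 : ∀ a, (∀ k : Fin N, n ≤ k.val → glue i a k = j k) ↔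
      ∀ k : Fin N, n ≤ k.val → i k = j k := fun a =>
    forall₂_congr fun k hk => by rw [glue_of_le i a hk]
  simp only [extend, h1, restrict_glue, mul_apply]
  split_ifs <;> simp

theorem extend_one (h : n ≤ N) : extend h 1 = 1 := by
  ext i j
  have h1 : i = j ↔ (∀ k : Fin N, n ≤ k.val → i k = j k) ∧ restrict h i = restrict h j :=
    ⟨fun h => by simp [h], fun ⟨h1, h2⟩ => by
      rw [← glue_restrict h (m := i) (i := j) h1, h2, glue_restrict h fun _ _ => rfl]⟩
  simp only [extend, one_apply, h1]
  split_ifs <;> simp_all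

theorem extend_mul_attachBits (h : n ≤ N) (A ρ : QMatrix n) (z : Fin N → Bool) :
    extend h A * attachBits h ρ z = attachBits h (A * ρ) z := by
  ext i j
  rw [extend_mul_apply]
  have h1 : ∀ a, (∀ k : Fin N, n ≤ k.val → glue i a k = z k ∧ j k = z k) ↔
      ∀ k : Fin N, n ≤ k.val → i k = z k ∧ j k = z k := fun a =>
    forall₂_congr fun k hk => by rw [glue_of_le i a hk]
  have h2 : ∀ a, (fun k => glue i a (Fin.castLE h k)) = a := restrict_glue h i
  simp only [attachBits, h1, h2, mul_apply]
  split_ifs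
  · rfl
  · simp

theorem attachBits_conjTranspose (h : n ≤ N) (ρ : QMatrix n) (z : Fin N → Bool) :
    (attachBits h ρ z)ᴴ = attachBits h ρᴴ z := by
  ext i j
  simp only [conjTranspose_apply, attachBits, @and_comm (j _ = _)]
  split_ifs <;> simp

theorem attachBits_mul_extend (h : n ≤ N) (A ρ : QMatrix n) (z : Fin N → Bool) :
    attachBits h ρ z * extend h A = attachBits h (ρ * A) z := by
  have := congrArg conjTranspose (extend_mul_attachBits h Aᴴ ρᴴ z)
  simpa only [conjTranspose_mul, extend_conjTranspose, attachBits_conjTranspose,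
    conjTranspose_conjTranspose] using this

theorem controlled_castLE (h : n ≤ N) (cs : Finset (Fin n)) (t : Fin n) (u : Matrix Bool Bool ℂ) :
    controlled (cs.image (Fin.castLE h)) (t.castLE h) u = extend h (controlled cs t u) := by
  ext i j
  have h1 : (∀ k, k ≠ t.castLE h → i k = j k) ↔
      (∀ k : Fin N, n ≤ k.val → i k = j k) ∧
        ∀ k, k ≠ t → restrict h i k = restrict h j k := by
    refine ⟨fun hk => ⟨fun k hn => hk k ?_, fun k ht => hk _ ?_⟩, fun ⟨h1, h2⟩ k hk => ?_⟩
    · rintro rfl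
      exact absurd t.isLt (not_lt.mpr hn)
    · simpa using ht
    · by_cases hn : n ≤ k.val
      · exact h1 k hn
      · exact h2 ⟨k, not_le.mp hn⟩ (fun hkt => hk (by rw [← hkt]; rfl))
  simp only [controlled, extend, h1, Finset.forall_mem_image]
  by_cases h2 : ∀ k : Fin N, n ≤ k.val → i k = j k
  · simp only [and_iff_right h2, if_pos h2]
    rfl
  · simp only [if_neg h2, if_neg fun h3 => h2 (And.left h3)]

theorem Gate.matrix_castLE (h : n ≤ N) (g : Gate n) :
    (g.castLE h).matrix = extend h g.matrix := by
  cases g <;> simp only [Gate.castLE, Gate.matrix, ← controlled_castLE] <;> simp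

theorem circuitMatrix_map_castLE (h : n ≤ N) (gs : List (Gate n)) :
    circuitMatrix (gs.map (Gate.castLE h)) = extend h (circuitMatrix gs) := by
  induction gs with
  | nil => simp [circuitMatrix, extend_one]
  | cons g gs ih => simp [circuitMatrix, ih, Gate.matrix_castLE, extend_mul]

end Extension

end QuantumProofs

namespace QuantumProofs
open Matrix

/-! ### The largest fidelity of an output of an isometry -/

section Fidelity

variable {l m : Type*} [Fintype l] [Fintype m]

theorem re_trace_mul_conjTranspose_nonneg (X : Matrix l m ℂ) : 0 ≤ (trace (X * Xᴴ)).re :=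
  (Complex.le_def.mp (posSemidef_self_mul_conjTranspose X).trace_nonneg).1

/-- The Cauchy–Schwarz inequality for the Hilbert–Schmidt inner product. -/
theorem re_trace_mul_sq_le (X : Matrix l m ℂ) (Y : Matrix m l ℂ) :
    (trace (X * Y)).re ^ 2 ≤ (trace (X * Xᴴ)).re * (trace (Yᴴ * Y)).re := by
  have h : ∀ t : ℝ, 0 ≤ (trace (Yᴴ * Y)).re * (t * t) + (-2 * (trace (X * Y)).re) * t +
      (trace (X * Xᴴ)).re := fun t => by
    have h1 := re_trace_mul_conjTranspose_nonneg (X - (t : ℂ) • Yᴴ)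
    have h2 : trace (Yᴴ * Xᴴ) = star (trace (X * Y)) := by
      rw [← conjTranspose_mul, trace_conjTranspose]
    have h3 : (X - (t : ℂ) • Yᴴ) * (X - (t : ℂ) • Yᴴ)ᴴ =
        X * Xᴴ - (t : ℂ) • (X * Y) - (t : ℂ) • (Yᴴ * Xᴴ) + ((t * t : ℝ) : ℂ) • (Yᴴ * Y) := by
      simp only [conjTranspose_sub, conjTranspose_smul, conjTranspose_conjTranspose,
        Complex.star_def, Complex.conj_ofReal, Matrix.sub_mul, Matrix.mul_sub, Matrix.smul_mul,
        Matrix.mul_smul, smul_sub, mul_smul, Complex.ofReal_mul]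
      abel
    rw [h3] at h1
    simp only [trace_add, trace_sub, trace_smul, h2, Complex.add_re, Complex.sub_re, smul_eq_mul,
      Complex.re_ofReal_mul, Complex.star_def, Complex.conj_re] at h1
    linarith
  have := discrim_le_zero h
  rw [discrim] at this
  linarith

variable [DecidableEq l] [DecidableEq m]

/-- A pseudo-inverse `D` of a positive semidefinite matrix `M`; the product `D M² D` is the
orthogonal projection to the range of `M`. -/
theorem exists_pseudoInverse {M : Matrix m m ℂ} (hM : 0 ≤ M) :
    ∃ D : Matrix m m ℂ, Dᴴ = D ∧ D * (M * M) = M ∧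
      (1 - D * (M * M) * D) * (1 - D * (M * M) * D)ᴴ = 1 - D * (M * M) * D := by
  have hs : IsSelfAdjoint M := .of_nonneg hM
  have hc : ∀ f : ℝ → ℝ, ContinuousOn f (spectrum ℝ M) := fun f =>
    (finite_real_spectrum (A := M)).continuousOn f
  have hid : cfc (fun x : ℝ => x) M = M := cfc_id' ℝ M
  have h1 : cfc (fun x : ℝ => x⁻¹) M * (M * M) = M := by
    have h := cfc_mul (fun x : ℝ => x⁻¹) (fun x => x * x) M (hc _) (hc _)
    rw [cfc_mul (fun x : ℝ => x) (fun x => x) M (hc _) (hc _), hid] at h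
    refine h.symm.trans ((cfc_congr fun x _ => ?_).trans hid)
    by_cases hx : x = 0
    · simp [hx]
    · simp [hx]
  have h2 : cfc (fun x : ℝ => x⁻¹) M * M = M * cfc (fun x : ℝ => x⁻¹) M := by
    have h := cfc_commute_cfc (fun x : ℝ => x⁻¹) (fun x => x) M
    rwa [hid] at h
  have h3 : (cfc (fun x : ℝ => x⁻¹) M)ᴴ = cfc (fun x : ℝ => x⁻¹) M :=
    (cfc_predicate _ _ : IsSelfAdjoint _)
  refine ⟨cfc (fun x : ℝ => x⁻¹) M, h3, h1, ?_⟩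
  have h4 : Mᴴ = M := hs
  have h5 : M * cfc (fun x : ℝ => x⁻¹) M * (M * cfc (fun x : ℝ => x⁻¹) M) =
      M * cfc (fun x : ℝ => x⁻¹) M := by
    nth_rw 1 [← h2]
    rw [← Matrix.mul_assoc, Matrix.mul_assoc _ M M, h1]
  rw [h1, conjTranspose_sub, conjTranspose_mul, h3, h4, conjTranspose_one, h2, Matrix.mul_sub,
    Matrix.mul_one, Matrix.sub_mul, Matrix.one_mul, h5, sub_self, sub_zero]

/-- If the Hermitian matrix `P` acts as the identity on the range of the state `A`, then the
fidelity of `A` with `S` is at most the trace of `P S P`.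

Let `R = √A`, `T = √S` and `M = √(R S R)`, with pseudo-inverse `D`. The trace of `M = D M²` is the
Hilbert–Schmidt product of `R D R T` and `T P`. The squared norm of the first factor is the trace of
`R E R`, where `E = D M² D` is a projection, hence at most `1`; that of the second one is the trace
of `P S P`. -/
theorem fidelity_le_of_mul_eq {N : ℕ} {A S P : QMatrix N} (hA : 0 ≤ A) (hA1 : trace A = 1)
    (hS : 0 ≤ S) (hP : Pᴴ = P) (hPA : P * CFC.sqrt A = CFC.sqrt A) :
    fidelity A S ≤ (trace (P * S * P)).re := by
  set R := CFC.sqrt A with hR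
  set T := CFC.sqrt S with hT
  have hRR : R * R = A := CFC.sqrt_mul_sqrt_self A
  have hTT : T * T = S := CFC.sqrt_mul_sqrt_self S
  have hRs : Rᴴ = R := (IsSelfAdjoint.of_nonneg (CFC.sqrt_nonneg A) :)
  have hTs : Tᴴ = T := (IsSelfAdjoint.of_nonneg (CFC.sqrt_nonneg S) :)
  have hRP : R * P = R := by
    have := congrArg conjTranspose hPA
    rwa [conjTranspose_mul, hP, hRs] at this
  have hM0 : 0 ≤ R * S * R := by
    have h := (nonneg_iff_posSemidef.mp hS).conjTranspose_mul_mul_same R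
    rw [hRs] at h
    exact h.nonneg
  rw [fidelity, ← hR]
  set M := CFC.sqrt (R * S * R) with hM
  have hMM : M * M = R * S * R := CFC.sqrt_mul_sqrt_self _
  obtain ⟨D, hDs, hDM, hE⟩ := exists_pseudoInverse (CFC.sqrt_nonneg (R * S * R))
  rw [← hM, hMM] at hDM hE
  have h1 : trace M = trace (R * D * R * T * (T * P)) := by
    have h : D * (R * S * R) = D * R * T * T * P * R := by
      simp only [Matrix.mul_assoc, hPA, ← hTT]
    rw [← hDM, h, trace_mul_comm]
    simp only [Matrix.mul_assoc]
  have h2 : (trace (R * D * R * T * (R * D * R * T)ᴴ)).re ≤ 1 := by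
    have h3 := re_trace_mul_conjTranspose_nonneg (R * (1 - D * (R * S * R) * D))
    have h4 : R * (1 - D * (R * S * R) * D) * (R * (1 - D * (R * S * R) * D))ᴴ =
        A - R * D * R * T * (R * D * R * T)ᴴ := by
      rw [conjTranspose_mul, Matrix.mul_assoc, ← Matrix.mul_assoc _ _ Rᴴ, hE]
      simp only [conjTranspose_mul, hRs, hDs, hTs, Matrix.mul_sub, Matrix.sub_mul, ← hTT, ← hRR,
        Matrix.mul_assoc, Matrix.one_mul]
    rw [h4, trace_sub, hA1] at h3
    simpa using h3
  have h5 : (T * P)ᴴ * (T * P) = P * S * P := by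
    rw [conjTranspose_mul, hP, hTs, ← hTT]
    simp only [Matrix.mul_assoc]
  have h6 := re_trace_mul_sq_le (R * D * R * T) (T * P)
  rw [← h1, h5] at h6
  have h7 := re_trace_mul_conjTranspose_nonneg (T * P)ᴴ
  rw [conjTranspose_conjTranspose, h5] at h7
  exact h6.trans (mul_le_of_le_one_left h7 h2)

/-- Conjugation with an isometry commutes with the square root. -/
theorem sqrt_isometry_conj {l m : Type*} [Fintype l] [Fintype m] [DecidableEq l] [DecidableEq m]
    {V : Matrix l m ℂ} (hV : Vᴴ * V = 1) {A : Matrix m m ℂ} (hA : 0 ≤ A) :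
    CFC.sqrt (V * A * Vᴴ) = V * CFC.sqrt A * Vᴴ := by
  refine CFC.sqrt_unique ?_ ?_
  · conv_rhs => rw [← CFC.sqrt_mul_sqrt_self A hA]
    simp only [Matrix.mul_assoc]
    rw [← Matrix.mul_assoc Vᴴ V, hV, Matrix.one_mul]
  · exact ((nonneg_iff_posSemidef.mp (CFC.sqrt_nonneg A)).mul_mul_conjTranspose_same V).nonneg

/-- The fidelity of `V ρ Vᴴ` with `S`, for an isometry `V`, is at most the trace of `Vᴴ S V`. -/
theorem fidelity_isometry_le {n N : ℕ} {V : Matrix (Fin N → Bool) (Fin n → Bool) ℂ}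
    (hV : Vᴴ * V = 1) (ρ : QState n) {S : QMatrix N} (hS : S.PosSemidef) :
    fidelity (V * ρ.mat * Vᴴ) S ≤ (trace (Vᴴ * S * V)).re := by
  have h1 := sqrt_isometry_conj hV ρ.posSemidef.nonneg
  have h2 := fidelity_le_of_mul_eq (P := V * Vᴴ) (ρ.posSemidef.mul_mul_conjTranspose_same V).nonneg
    (by rw [Matrix.mul_assoc, trace_mul_comm, Matrix.mul_assoc, hV, Matrix.mul_one, ρ.trace_eq_one])
    hS.nonneg (by simp) (by
      rw [h1]
      simp only [Matrix.mul_assoc]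
      rw [← Matrix.mul_assoc Vᴴ V, hV, Matrix.one_mul])
  refine h2.trans_eq (congrArg Complex.re ?_)
  rw [Matrix.mul_assoc V, Matrix.mul_assoc V, trace_mul_comm]
  simp only [Matrix.mul_assoc]
  rw [hV, Matrix.mul_one]

theorem nonempty_qState (n : ℕ) : Nonempty (QState n) :=
  ⟨⟨diagonal (Pi.single (fun _ => false) 1), .diagonal fun i => by
    by_cases h : i = fun _ => false
    · subst h; simp
    · simp [h], by simp [trace_diagonal]⟩⟩

/-- The bound of `fidelity_isometry_le` is attained by the state proportional to `Vᴴ S V`. -/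
theorem exists_fidelity_isometry_ge {n N : ℕ} {V : Matrix (Fin N → Bool) (Fin n → Bool) ℂ}
    (hV : Vᴴ * V = 1) {S : QMatrix N} (hS : S.PosSemidef) :
    ∃ ρ : QState n, (trace (Vᴴ * S * V)).re ≤ fidelity (V * ρ.mat * Vᴴ) S := by
  have hB := hS.conjTranspose_mul_mul_same V
  set B := Vᴴ * S * V with hBdef
  set τ := (trace B).re with hτ
  have hτB : trace B = (τ : ℂ) :=
    Complex.ext rfl (by simpa using (Complex.le_def.mp hB.trace_nonneg).2.symm)
  rcases le_or_gt τ 0 with h0 | h0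
  -- A fidelity is a square, so every state will do if there is nothing to normalize.
  · obtain ⟨ρ⟩ := nonempty_qState n
    exact ⟨ρ, h0.trans (sq_nonneg _)⟩
  have hc : (0 : ℂ) ≤ ((τ⁻¹ : ℝ) : ℂ) := by exact_mod_cast (inv_pos.mpr h0).le
  refine ⟨⟨((τ⁻¹ : ℝ) : ℂ) • B, hB.smul hc, ?_⟩, ?_⟩
  · rw [trace_smul, hτB, smul_eq_mul, ← Complex.ofReal_mul, inv_mul_cancel₀ h0.ne',
      Complex.ofReal_one]
  set ρ := ((τ⁻¹ : ℝ) : ℂ) • B with hρ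
  have hρ0 : 0 ≤ ρ := (hB.smul hc).nonneg
  have hBρ : B = (τ : ℂ) • ρ := by
    rw [hρ, smul_smul, ← Complex.ofReal_mul, mul_inv_cancel₀ h0.ne', Complex.ofReal_one, one_smul]
  have h1 := sqrt_isometry_conj hV hρ0
  have hA0 : 0 ≤ V * ρ * Vᴴ := ((hB.smul hc).mul_mul_conjTranspose_same V).nonneg
  have h2 : CFC.sqrt (V * ρ * Vᴴ) * S * CFC.sqrt (V * ρ * Vᴴ) =
      ((τ : ℝ) : ℂ) • ((V * ρ * Vᴴ) * (V * ρ * Vᴴ)) := by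
    rw [h1]
    have h3 : V * CFC.sqrt ρ * Vᴴ * S * (V * CFC.sqrt ρ * Vᴴ) =
        V * (CFC.sqrt ρ * B * CFC.sqrt ρ) * Vᴴ := by
      rw [hBdef]
      simp only [Matrix.mul_assoc]
    have h4 : CFC.sqrt ρ * ρ * CFC.sqrt ρ = ρ * ρ := by
      have h := CFC.sqrt_mul_sqrt_self ρ hρ0
      generalize CFC.sqrt ρ = r at h
      simp only [← h, Matrix.mul_assoc]
    have h5 : V * ρ * Vᴴ * (V * ρ * Vᴴ) = V * (ρ * ρ) * Vᴴ := by
      simp only [Matrix.mul_assoc]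
      rw [← Matrix.mul_assoc Vᴴ V, hV, Matrix.one_mul]
    rw [h3, h5, hBρ, Matrix.mul_smul, Matrix.smul_mul, h4, Matrix.mul_smul, Matrix.smul_mul]
  have h3 : CFC.sqrt (((τ : ℝ) : ℂ) • ((V * ρ * Vᴴ) * (V * ρ * Vᴴ))) =
      ((√τ : ℝ) : ℂ) • (V * ρ * Vᴴ) := by
    refine CFC.sqrt_unique ?_ ?_
    · rw [Matrix.smul_mul, Matrix.mul_smul, smul_smul, ← Complex.ofReal_mul,
        Real.mul_self_sqrt h0.le]
    · have hs : (0 : ℂ) ≤ ((√τ : ℝ) : ℂ) := by exact_mod_cast Real.sqrt_nonneg τ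
      exact ((nonneg_iff_posSemidef.mp hA0).smul hs).nonneg
  have h4 : trace (V * ρ * Vᴴ) = 1 := by
    rw [Matrix.mul_assoc, trace_mul_comm, Matrix.mul_assoc, hV, Matrix.mul_one, hρ, trace_smul, hτB,
      smul_eq_mul, ← Complex.ofReal_mul, inv_mul_cancel₀ h0.ne', Complex.ofReal_one]
  rw [fidelity, h2, h3, trace_smul, h4, smul_eq_mul, mul_one, Complex.ofReal_re, Real.sq_sqrt h0.le]

end Fidelity

end QuantumProofs

namespace QuantumProofs
open Function Matrix

/-! ### Reversible classical circuits -/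

section Classical

variable {N : ℕ}

/-- The operator that maps the basis state of the string `j` to that of the string `f j`. -/
def basisMap (f : (Fin N → Bool) → (Fin N → Bool)) : QMatrix N :=
  fun i j => if i = f j then 1 else 0

theorem basisMap_mul (f g : (Fin N → Bool) → (Fin N → Bool)) :
    basisMap f * basisMap g = basisMap (f ∘ g) := by
  ext i j
  simp [basisMap, mul_apply]

theorem basisMap_id : basisMap (id : (Fin N → Bool) → (Fin N → Bool)) = 1 := by
  ext i j
  simp [basisMap, one_apply]

theorem basisMap_conj_apply {f : (Fin N → Bool) → (Fin N → Bool)} (hf : Injective f) (M : QMatrix N)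
    (i j : Fin N → Bool) : (basisMap f * M * (basisMap f)ᴴ) (f i) (f j) = M i j := by
  simp [basisMap, mul_apply, hf.eq_iff]

/-- The probability of a measurement outcome after a reversible classical circuit. -/
theorem sum_basisMap_conj {f : (Fin N → Bool) → (Fin N → Bool)} (hf : Bijective f) (M : QMatrix N)
    (p : (Fin N → Bool) → Prop) [DecidablePred p] :
    ∑ b, (if p b then ((basisMap f * M * (basisMap f)ᴴ) b b).re else 0) =
      ∑ b, if p (f b) then (M b b).re else 0 := by
  rw [← hf.sum_comp]
  simp only [basisMap_conj_apply hf.injective]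

/-- Flips the bit at position `t`. -/
def flipAt (t : Fin N) (s : Fin N → Bool) : Fin N → Bool := update s t (!s t)

theorem flipAt_involutive (t : Fin N) : Involutive (flipAt t) := fun s => by simp [flipAt]

theorem flipAt_self (t : Fin N) (s : Fin N → Bool) : flipAt t s t = !s t := by simp [flipAt]

theorem flipAt_of_ne {t k : Fin N} (h : k ≠ t) (s : Fin N → Bool) : flipAt t s k = s k := by
  simp [flipAt, h]

/-- The action of a controlled NOT gate on bit strings. -/
def controlledFlip (cs : Finset (Fin N)) (t : Fin N) (s : Fin N → Bool) : Fin N → Bool :=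
  if ∀ k ∈ cs, s k = true then flipAt t s else s

theorem controlledFlip_involutive {cs : Finset (Fin N)} {t : Fin N} (ht : t ∉ cs) :
    Involutive (controlledFlip cs t) := fun s => by
  have h : (∀ k ∈ cs, flipAt t s k = true) ↔ ∀ k ∈ cs, s k = true :=
    forall₂_congr fun k hk => by rw [flipAt_of_ne (show k ≠ t by rintro rfl; exact ht hk)]
  by_cases hs : ∀ k ∈ cs, s k = true
  · rw [controlledFlip, controlledFlip, if_pos hs, if_pos (h.mpr hs), flipAt_involutive]
  · rw [controlledFlip, controlledFlip, if_neg hs, if_neg hs]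

theorem eq_update_iff_of_ne {i j : Fin N → Bool} (t : Fin N) (b : Bool) :
    i = update j t b ↔ (∀ k, k ≠ t → i k = j k) ∧ i t = b := by
  rw [eq_update_iff, and_comm]

theorem controlled_pauliX (cs : Finset (Fin N)) (t : Fin N) :
    controlled cs t pauliX = basisMap (controlledFlip cs t) := by
  ext i j
  by_cases hs : ∀ k ∈ cs, j k = true
  · simp only [controlled, basisMap, controlledFlip, if_pos hs, flipAt, eq_update_iff_of_ne, pauliX]
    by_cases h : ∀ k, k ≠ t → i k = j k
    · simp only [if_pos h, and_iff_right h]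
      cases i t <;> cases j t <;> simp
    · simp only [if_neg h, if_neg fun h1 => h (And.left h1)]
  · have h := eq_update_iff_of_ne (i := i) (j := j) t (j t)
    rw [update_eq_self] at h
    simp only [controlled, basisMap, controlledFlip, if_neg hs, h]
    split_ifs <;> simp_all

theorem circuitMatrix_singleton (g : Gate N) : circuitMatrix [g] = g.matrix := by
  simp [circuitMatrix]

theorem circuitMatrix_xCircuit {w : ℕ} (h : w < N) :
    circuitMatrix (xCircuit N w) = basisMap (flipAt ⟨w, h⟩) := by
  rw [xCircuit, dif_pos h, circuitMatrix_singleton, Gate.matrix, controlled_pauliX]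
  congr 1
  funext s
  simp [controlledFlip]

theorem circuitMatrix_toffoliCircuit {a b t : ℕ}
    (h : (a < N ∧ b < N ∧ t < N) ∧ a ≠ b ∧ a ≠ t ∧ b ≠ t) :
    circuitMatrix (toffoliCircuit N a b t) =
      basisMap (controlledFlip {⟨a, h.1.1⟩, ⟨b, h.1.2.1⟩} ⟨t, h.1.2.2⟩) := by
  rw [toffoliCircuit, dif_pos h, circuitMatrix_singleton, Gate.matrix, controlled_pauliX]

/-- Adds the bit string `x` to the bits from position `c` on. -/
def addBits (c : ℕ) (x : List Bool) (s : Fin N → Bool) : Fin N → Bool :=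
  fun k => s k ^^ (decide (c ≤ k.val) && x.getD (k.val - c) false)

theorem addBits_involutive (c : ℕ) (x : List Bool) :
    Involutive (addBits c x : (Fin N → Bool) → _) := fun s => by
  funext k
  simp [addBits]

theorem circuitMatrix_wipeCircuit (x : List Bool) (c : ℕ) (h : c + x.length ≤ N) :
    circuitMatrix (wipeCircuit N c x) = basisMap (addBits c x) := by
  induction x generalizing c with
  | nil =>
    rw [wipeCircuit, circuitMatrix, ← basisMap_id]
    congr 1
    funext s k
    simp [addBits]
  | cons b x ih =>
    rw [List.length_cons] at h
    have h1 : ∀ k : ℕ, (decide (c ≤ k) && (b :: x).getD (k - c) false) =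
        ((decide (k = c) && b) ^^ (decide (c + 1 ≤ k) && x.getD (k - (c + 1)) false)) := fun k => by
      rcases lt_trichotomy k c with h | rfl | h
      · simp [show ¬ c ≤ k by omega, show ¬ c + 1 ≤ k by omega, h.ne]
      · simp
      · obtain ⟨d, rfl⟩ := Nat.exists_eq_add_of_lt h
        simp [show c + d + 1 - c = d + 1 by omega, show c + d + 1 - (c + 1) = d by omega,
          show c ≤ c + d + 1 by omega, show c + d + 1 ≠ c by omega]
    rw [wipeCircuit, circuitMatrix_append, ih _ (by omega)]
    cases b
    · simp only [Bool.false_eq_true, if_false, circuitMatrix, Matrix.one_mul]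
      congr 1
      funext s k
      simp only [addBits, h1, Bool.and_false, Bool.false_xor]
    · rw [if_pos rfl, circuitMatrix_xCircuit (by omega), basisMap_mul]
      congr 1
      funext s k
      by_cases hk : k = ⟨c, by omega⟩
      · subst hk
        simp [flipAt, addBits]
      · have hk' : k.val ≠ c := fun h => hk (Fin.ext h)
        simp only [Function.comp_apply, flipAt_of_ne hk, addBits, h1, hk', decide_false,
          Bool.false_and, Bool.false_xor]

/-- Adding `x` to the input register turns it from `x` to zeros. -/
theorem addBits_conj_attachBits {p : ℕ} (hp : p ≤ N) (ρ : QMatrix p) (x : List Bool) :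
    basisMap (addBits p x) * attachBits hp ρ (fun k => x.getD (k.val - p) false) *
      (basisMap (addBits p x))ᴴ = attachZeros hp ρ := by
  have hinv := addBits_involutive (N := N) p x
  ext i j
  obtain ⟨i, rfl⟩ := hinv.surjective i
  obtain ⟨j, rfl⟩ := hinv.surjective j
  rw [basisMap_conj_apply hinv.injective, attachZeros, attachBits, attachBits]
  have h1 : ∀ s : Fin N → Bool, (fun k => addBits p x s (Fin.castLE hp k)) =
      fun k => s (Fin.castLE hp k) := fun s => by
    funext k
    simp only [addBits, Fin.val_castLE, not_le.mpr k.isLt, decide_false, Bool.false_and,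
      Bool.xor_false]
  have h2 : ∀ (s : Fin N → Bool) (k : Fin N), p ≤ k.val →
      (addBits p x s k = false ↔ s k = x.getD (k.val - p) false) := fun s k hk => by
    simp only [addBits, hk, decide_true, Bool.true_and]
    cases s k <;> cases x.getD (k.val - p) false <;> simp
  have h3 : (∀ k : Fin N, p ≤ k.val → addBits p x i k = false ∧ addBits p x j k = false) ↔
      ∀ k : Fin N, p ≤ k.val → i k = x.getD (k.val - p) false ∧ j k = x.getD (k.val - p) false :=
    forall₂_congr fun k hk => by rw [h2 i k hk, h2 j k hk]
  simp only [h1, h3]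

/-- The last gate of the chain leaves on wire `a` the conjunction of wire `a - k` and the negations
of the wires `c - k, …, c - 1`, provided that the wires in between are `0` at the start. -/
theorem circuitMatrix_chainCircuit {c a : ℕ} (ha : a < N) (k : ℕ) (hk : k ≤ c) (hca : c + k ≤ a) :
    ∃ f : (Fin N → Bool) → (Fin N → Bool), Bijective f ∧
      circuitMatrix (chainCircuit N c a k) = basisMap f ∧
      ∀ s : Fin N → Bool, (∀ j : Fin N, a - k < j.val → j.val ≤ a → s j = false) →
        (f s ⟨a, ha⟩ = true ↔ s ⟨a - k, by omega⟩ = true ∧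
          ∀ j : Fin N, c - k ≤ j.val → j.val < c → s j = false) := by
  induction k with
  | zero =>
    refine ⟨id, bijective_id, ?_, fun s _ => ?_⟩
    · rw [chainCircuit, circuitMatrix, basisMap_id]
    · simp
      intros; omega
  | succ k ih =>
    obtain ⟨f, hf, hM, hfs⟩ := ih (by omega) (by omega)
    have hT : (a - k - 1 < N ∧ c - k - 1 < N ∧ a - k < N) ∧ a - k - 1 ≠ c - k - 1 ∧
        a - k - 1 ≠ a - k ∧ c - k - 1 ≠ a - k := by omega
    have hX := circuitMatrix_xCircuit hT.1.2.1
    set g : (Fin N → Bool) → (Fin N → Bool) := controlledFlip {⟨a - k - 1, hT.1.1⟩,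
      ⟨c - k - 1, hT.1.2.1⟩} ⟨a - k, hT.1.2.2⟩ with hg
    have hgi : Involutive g := controlledFlip_involutive (by simp; omega)
    refine ⟨f ∘ (g ∘ flipAt ⟨c - k - 1, hT.1.2.1⟩),
      hf.comp (hgi.bijective.comp (flipAt_involutive _).bijective), ?_, fun s hs => ?_⟩
    · rw [chainCircuit, circuitMatrix_append, circuitMatrix_append, hX,
        circuitMatrix_toffoliCircuit hT, hM, basisMap_mul, basisMap_mul]
    · set s' := g (flipAt ⟨c - k - 1, hT.1.2.1⟩ s) with hs'
      have h1 : ∀ j : Fin N, j.val ≠ c - k - 1 → j.val ≠ a - k → s' j = s j := fun j h1 h2 => by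
        have h3 : flipAt ⟨c - k - 1, hT.1.2.1⟩ s j = s j := flipAt_of_ne (fun h => h1 (by rw [h])) s
        rw [hs', hg, controlledFlip]
        split_ifs
        · rw [flipAt_of_ne (fun h => h2 (by rw [h])), h3]
        · exact h3
      have h2 : s' ⟨a - k, hT.1.2.2⟩ = true ↔ s ⟨a - k - 1, hT.1.1⟩ = true ∧
          s ⟨c - k - 1, hT.1.2.1⟩ = false := by
        have h3 : flipAt ⟨c - k - 1, hT.1.2.1⟩ s ⟨a - k, hT.1.2.2⟩ = false := by
          rw [flipAt_of_ne (by simp; omega)]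
          exact hs _ (by dsimp only; omega) (Nat.sub_le _ _)
        have h4 : flipAt ⟨c - k - 1, hT.1.2.1⟩ s ⟨a - k - 1, hT.1.1⟩ = s ⟨a - k - 1, hT.1.1⟩ :=
          flipAt_of_ne (by simp; omega) s
        rw [hs', hg, controlledFlip]
        simp only [Finset.mem_insert, Finset.mem_singleton, forall_eq_or_imp, forall_eq, h4,
          flipAt_self, Bool.not_eq_true']
        split_ifs with h5
        · simp [flipAt_self, h3, h5]
        · simp [h3, h5]
      refine (hfs s' fun j hj hj' => ?_).trans ?_
      · rw [h1 j (by omega) (by omega)]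
        exact hs j (by omega) hj'
      · rw [h2]
        constructor
        · rintro ⟨⟨h3, h4⟩, h5⟩
          refine ⟨h3, fun j hj hj' => ?_⟩
          by_cases h6 : j.val = c - k - 1
          · rwa [show j = ⟨c - k - 1, hT.1.2.1⟩ from Fin.ext h6]
          · rw [← h1 j h6 (by omega)]
            exact h5 j (by omega) hj'
        · rintro ⟨h3, h4⟩
          refine ⟨⟨h3, h4 _ (by dsimp only; omega) (by dsimp only; omega)⟩, fun j hj hj' => ?_⟩
          rw [h1 j (by omega) (by omega)]
          exact h4 j (by omega) hj'

end Classical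

end QuantumProofs

namespace QuantumProofs
open Function Matrix

/-! ### Acceptance probabilities and fidelities -/

section Overlap

variable {n N : ℕ}

/-- The isometry that appends zeros to the basis states of `n` qubits. -/
def padMatrix (n N : ℕ) : Matrix (Fin N → Bool) (Fin n → Bool) ℂ :=
  fun i a => if i = glue (fun _ => false) a then 1 else 0

theorem padMatrix_conj_apply (M : QMatrix N) (a b : Fin n → Bool) :
    ((padMatrix n N)ᴴ * M * padMatrix n N) a b =
      M (glue (fun _ => false) a) (glue (fun _ => false) b) := by
  simp [padMatrix, mul_apply]

theorem padMatrix_conjTranspose_mul (h : n ≤ N) : (padMatrix n N)ᴴ * padMatrix n N = 1 := by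
  ext a b
  simp [padMatrix, mul_apply, one_apply, (glue_injective h _).eq_iff, eq_comm]

theorem attachZeros_apply_glue (h : n ≤ N) (ρ : QMatrix n) (a b : Fin n → Bool) :
    attachZeros h ρ (glue (fun _ => false) a) (glue (fun _ => false) b) = ρ a b := by
  rw [attachZeros, attachBits, if_pos fun k hk => ⟨glue_of_le _ _ hk, glue_of_le _ _ hk⟩]
  exact congrArg₂ ρ (restrict_glue h _ a) (restrict_glue h _ b)

theorem attachZeros_eq (h : n ≤ N) (ρ : QMatrix n) :
    attachZeros h ρ = padMatrix n N * ρ * (padMatrix n N)ᴴ := by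
  have h0 : ∀ (i : Fin N → Bool) (a : Fin n → Bool),
      ¬ (∀ k : Fin N, n ≤ k.val → i k = false) → padMatrix n N i a = 0 := fun i a hi =>
    if_neg fun hia => hi fun k hk => by rw [hia, glue_of_le _ _ hk]
  ext i j
  by_cases hi : ∀ k : Fin N, n ≤ k.val → i k = false
  · by_cases hj : ∀ k : Fin N, n ≤ k.val → j k = false
    · rw [← glue_restrict h hi, ← glue_restrict h hj, attachZeros_apply_glue]
      simp [padMatrix, mul_apply, (glue_injective h _).eq_iff]
    · rw [attachZeros, attachBits, if_neg fun hk => hj fun k hn => (hk k hn).2, mul_apply]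
      simp [h0 j _ hj]
  · rw [attachZeros, attachBits, if_neg fun hk => hi fun k hn => (hk k hn).1, mul_apply]
    simp [mul_apply, h0 i _ hi]

theorem attachZeros_posSemidef (h : n ≤ N) {ρ : QMatrix n} (hρ : ρ.PosSemidef) :
    (attachZeros h ρ).PosSemidef := by
  rw [attachZeros_eq]
  exact hρ.mul_mul_conjTranspose_same _

theorem attachZeros_attachZeros {l : ℕ} (h₁ : l ≤ n) (h₂ : n ≤ N) (ρ : QMatrix l) :
    attachZeros h₂ (attachZeros h₁ ρ) = attachZeros (h₁.trans h₂) ρ := by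
  ext i j
  simp only [attachZeros, attachBits]
  have h : (∀ k : Fin N, l ≤ k.val → i k = false ∧ j k = false) ↔
      (∀ k : Fin N, n ≤ k.val → i k = false ∧ j k = false) ∧
      ∀ k : Fin n, l ≤ k.val → i (Fin.castLE h₂ k) = false ∧ j (Fin.castLE h₂ k) = false := by
    refine ⟨fun h => ⟨fun k hk => h k (h₁.trans hk), fun k hk => h _ hk⟩, fun ⟨h, h'⟩ k hk => ?_⟩
    by_cases hn : n ≤ k.val
    · exact h k hn
    · exact h' ⟨k, not_le.mp hn⟩ hk
  simp only [h, ite_and]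
  rfl

/-- The probability that, on the state `σ ⊗ |0 ⋯ 0⟩⟨0 ⋯ 0|`, the inverse of a circuit produces zeros
from qubit `n` on. -/
noncomputable def zeroProb {m : ℕ} (n : ℕ) (h : m ≤ N) (gs : List (Gate N)) (σ : QMatrix m) : ℝ :=
  ∑ b, if ∀ k : Fin N, n ≤ k.val → b k = false then
    (((circuitMatrix gs)ᴴ * attachZeros h σ * circuitMatrix gs) b b).re else 0

theorem zeroProb_eq_trace {m : ℕ} (hn : n ≤ N) (h : m ≤ N) (gs : List (Gate N)) (σ : QMatrix m) :
    zeroProb n h gs σ = (trace ((circuitMatrix gs * padMatrix n N)ᴴ * attachZeros h σ *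
      (circuitMatrix gs * padMatrix n N))).re := by
  have h1 : (circuitMatrix gs * padMatrix n N)ᴴ * attachZeros h σ *
      (circuitMatrix gs * padMatrix n N) = (padMatrix n N)ᴴ * ((circuitMatrix gs)ᴴ *
        attachZeros h σ * circuitMatrix gs) * padMatrix n N := by
    simp only [conjTranspose_mul, Matrix.mul_assoc]
  rw [h1, trace, Complex.re_sum, zeroProb, sum_eq_sum_glue hn _ (fun _ => false)]
  · refine Finset.sum_congr rfl fun a _ => ?_
    rw [if_pos fun k hk => glue_of_le _ _ hk, Matrix.diag_apply, padMatrix_conj_apply]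
  · exact fun m hm => if_neg hm

theorem circuit_isometry (hn : n ≤ N) (gs : List (Gate N)) :
    (circuitMatrix gs * padMatrix n N)ᴴ * (circuitMatrix gs * padMatrix n N) = 1 := by
  rw [conjTranspose_mul, Matrix.mul_assoc, ← Matrix.mul_assoc (circuitMatrix gs)ᴴ,
    circuitMatrix_conjTranspose_mul, Matrix.one_mul, padMatrix_conjTranspose_mul hn]

theorem IsometryCircuit.output_eq (C : IsometryCircuit) (ρ : QState C.n) :
    C.output ρ = circuitMatrix C.gates * padMatrix C.n (C.m₁ + C.m₂) * ρ.mat *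
      (circuitMatrix C.gates * padMatrix C.n (C.m₁ + C.m₂))ᴴ := by
  rw [output, attachZeros_eq]
  simp only [conjTranspose_mul, Matrix.mul_assoc]

/-- The largest squared fidelity of an output of the isometry with `σ ⊗ |0 ⋯ 0⟩⟨0 ⋯ 0|`. -/
noncomputable def IsometryCircuit.maxFidelity (C : IsometryCircuit) (σ : QState C.m₁) : ℝ :=
  zeroProb C.n (Nat.le_add_right C.m₁ C.m₂) C.gates σ.mat

theorem IsometryCircuit.paddedFidelity_le (C : IsometryCircuit) (ρ : QState C.n)
    (σ : QState C.m₁) : C.paddedFidelity ρ σ ≤ C.maxFidelity σ := by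
  rw [paddedFidelity, output_eq, maxFidelity, zeroProb_eq_trace C.le]
  exact fidelity_isometry_le (circuit_isometry C.le _) ρ (attachZeros_posSemidef _ σ.posSemidef)

theorem IsometryCircuit.exists_maxFidelity_le (C : IsometryCircuit) (σ : QState C.m₁) :
    ∃ ρ : QState C.n, C.maxFidelity σ ≤ C.paddedFidelity ρ σ := by
  obtain ⟨ρ, hρ⟩ := exists_fidelity_isometry_ge (circuit_isometry C.le C.gates)
    (attachZeros_posSemidef (Nat.le_add_right C.m₁ C.m₂) σ.posSemidef)
  exact ⟨ρ, by rwa [paddedFidelity, output_eq, maxFidelity, zeroProb_eq_trace C.le]⟩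

/-- The left side is the probability that the last qubit is `1` after running the circuit `gs` on
the state `ρ`, followed by the bits of `x` and zeros. On the right side, the inverse of the circuit
`wipe · gs⁻¹ · X` writes `x` onto the zeros, runs `gs` and flips the last qubit. -/
theorem sum_last_eq_zeroProb {p : ℕ} (hp : p ≤ N) (hN : N - 1 < N) (gs : List (Gate N))
    (x : List Bool) (hx : p + x.length ≤ N) (ρ : QMatrix p) :
    (∑ b : Fin N → Bool, if b ⟨N - 1, hN⟩ = true then ((circuitMatrix gs *
      attachBits hp ρ (fun k => x.getD (k.val - p) false) * (circuitMatrix gs)ᴴ) b b).re else 0) =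
    zeroProb (N - 1) hp (xCircuit N (N - 1) ++ invCircuit gs ++ wipeCircuit N p x) ρ := by
  have hX := circuitMatrix_xCircuit hN
  set X : QMatrix N := basisMap (flipAt ⟨N - 1, hN⟩) with hXdef
  have hXX : X * Xᴴ = 1 := by rw [← hX, circuitMatrix_mul_conjTranspose]
  have hU : circuitMatrix (xCircuit N (N - 1) ++ invCircuit gs ++ wipeCircuit N p x) =
      circuitMatrix (wipeCircuit N p x) * ((circuitMatrix gs)ᴴ * X) := by
    rw [circuitMatrix_append, circuitMatrix_append, circuitMatrix_invCircuit, ← hX]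
  rw [zeroProb, hU]
  set M : QMatrix N := (circuitMatrix (wipeCircuit N p x) * ((circuitMatrix gs)ᴴ * X))ᴴ *
    attachZeros hp ρ * (circuitMatrix (wipeCircuit N p x) * ((circuitMatrix gs)ᴴ * X)) with hM
  have hF : circuitMatrix gs * attachBits hp ρ (fun k => x.getD (k.val - p) false) *
      (circuitMatrix gs)ᴴ = X * M * Xᴴ := by
    have hWW := circuitMatrix_conjTranspose_mul (wipeCircuit N p x)
    rw [hM, ← addBits_conj_attachBits _ ρ x, ← circuitMatrix_wipeCircuit x p hx]
    generalize circuitMatrix (wipeCircuit N p x) = W at hWW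
    simp only [conjTranspose_mul, conjTranspose_conjTranspose, Matrix.mul_assoc]
    rw [hXX, ← Matrix.mul_assoc X Xᴴ, hXX, ← Matrix.mul_assoc Wᴴ W, hWW,
      Matrix.one_mul, Matrix.one_mul, ← Matrix.mul_assoc Wᴴ W, hWW, Matrix.one_mul, Matrix.mul_one]
  rw [hF, hXdef, sum_basisMap_conj (flipAt_involutive _).bijective]
  refine Finset.sum_congr rfl fun b _ => if_congr ?_ rfl rfl
  rw [flipAt_self, Bool.not_eq_true']
  refine ⟨fun h k hk => ?_, fun h => h ⟨N - 1, hN⟩ le_rfl⟩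
  rwa [show k = ⟨N - 1, hN⟩ from Fin.ext (by have := k.isLt; dsimp only; omega)]

/-- The left side is the probability that the last qubit is `1` after clearing the bits of `x`,
undoing the circuit `gs` and computing on the last qubit the conjunction of the negations of the
qubits `n, …, m - 1`. The wire `w`, set to `1`, is the first link of the chain. -/
theorem sum_last_eq_zeroProb_of_chain {m₁ m w c : ℕ} (h₁ : m₁ ≤ m) (hn : n ≤ m) (hm : m ≤ N)
    (hmw : m ≤ w) (hw : m - n + w = N - 1) (hN : N - 1 < N) (hc : c = m) (h0 : m₁ ≤ N)
    (gs : List (Gate m)) (x : List Bool) (hx : m₁ + x.length ≤ N) (σ : QMatrix m₁) :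
    (∑ b : Fin N → Bool, if b ⟨N - 1, hN⟩ = true then ((circuitMatrix
        (wipeCircuit N m₁ x ++ (invCircuit gs).map (Gate.castLE hm) ++
          (xCircuit N w ++ chainCircuit N c (m - n + w) (m - n))) *
      attachBits h0 σ (fun k => x.getD (k.val - m₁) false) *
        (circuitMatrix (wipeCircuit N m₁ x ++ (invCircuit gs).map (Gate.castLE hm) ++
          (xCircuit N w ++ chainCircuit N c (m - n + w) (m - n))))ᴴ) b b).re else 0) =
    zeroProb n h₁ gs σ := by
  subst hc
  have hanc : w < N := by omega
  set M := (circuitMatrix gs)ᴴ * attachZeros h₁ σ * circuitMatrix gs with hM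
  obtain ⟨f, hf, hfM, hfs⟩ := circuitMatrix_chainCircuit (N := N) (c := c)
    (a := c - n + w) (by omega) (c - n) (by omega) (by omega)
  set g := f ∘ flipAt ⟨w, hanc⟩ with hg
  have hgb : Bijective g := hf.comp (flipAt_involutive _).bijective
  have hU : circuitMatrix (wipeCircuit N m₁ x ++ (invCircuit gs).map (Gate.castLE hm) ++
      (xCircuit N w ++ chainCircuit N c (c - n + w) (c - n))) =
      basisMap g * (extend hm (circuitMatrix gs)ᴴ * basisMap (addBits m₁ x)) := by
    rw [circuitMatrix_append, circuitMatrix_append, circuitMatrix_append,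
      circuitMatrix_map_castLE hm, circuitMatrix_invCircuit, circuitMatrix_wipeCircuit x m₁ hx, hfM,
      circuitMatrix_xCircuit hanc, basisMap_mul]
  have hF : basisMap g * (extend hm (circuitMatrix gs)ᴴ * basisMap (addBits m₁ x)) *
      attachBits h0 σ (fun k => x.getD (k.val - m₁) false) *
      (basisMap g * (extend hm (circuitMatrix gs)ᴴ * basisMap (addBits m₁ x)))ᴴ =
      basisMap g * attachZeros hm M * (basisMap g)ᴴ := by
    have h1 := addBits_conj_attachBits (N := N) h0 σ x
    rw [← attachZeros_attachZeros h₁ hm] at h1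
    have h2 : extend hm (circuitMatrix gs)ᴴ * attachZeros hm (attachZeros h₁ σ) *
        extend hm (circuitMatrix gs) = attachZeros hm M := by
      rw [attachZeros, extend_mul_attachBits, attachBits_mul_extend, hM]
      rfl
    rw [← h2, ← h1]
    simp only [conjTranspose_mul, extend_conjTranspose, conjTranspose_conjTranspose,
      Matrix.mul_assoc]
  rw [hU, hF, sum_basisMap_conj hgb, sum_eq_sum_glue hm _ (fun _ => false), zeroProb]
  · refine Finset.sum_congr rfl fun b _ => if_congr ?_ ?_ rfl
    · set s : Fin N → Bool := glue (fun _ => false) b with hs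
      have hs0 : ∀ k : Fin N, c ≤ k.val → s k = false := fun k hk => glue_of_le _ _ hk
      have h1 : ∀ k : Fin N, k.val ≠ w → flipAt ⟨w, hanc⟩ s k = s k := fun k hk =>
        flipAt_of_ne (fun h => hk (by rw [h])) s
      have h2 := hfs (flipAt ⟨w, hanc⟩ s) fun j hj _ => by
        rw [h1 j (by omega), hs0 j (by omega)]
      have h3 : flipAt ⟨w, hanc⟩ s ⟨c - n + w - (c - n), by omega⟩ = true := by
        have h4 : (⟨c - n + w - (c - n), by omega⟩ : Fin N) = ⟨w, hanc⟩ :=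
          Fin.ext (Nat.add_sub_cancel_left ..)
        rw [h4, flipAt_self, hs0 _ hmw]
        rfl
      have h5 : (⟨c - n + w, by omega⟩ : Fin N) = ⟨N - 1, hN⟩ := Fin.ext hw
      rw [h5] at h2
      refine h2.trans ((and_iff_right h3).trans ⟨fun h k hk => ?_, fun h j hj hj' => ?_⟩)
      · have h6 := h (k.castLE hm) (by simp; omega) k.isLt
        rw [h1 _ (by simp; omega)] at h6
        exact (congrFun (restrict_glue hm _ b) k).symm.trans h6
      · rw [h1 j (by omega)]
        exact (congrFun (restrict_glue hm _ b) ⟨j, hj'⟩).trans (h _ (by dsimp only; omega))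
    · rw [attachZeros_apply_glue]
  · intro m hm'
    have h3 : attachZeros hm M m m = 0 := if_neg fun hk => hm' fun k hn => (hk k hn).1
    rw [h3]
    simp

/-- A verification circuit accepts a proof with the probability that is the largest fidelity with
that proof of an output of the isometry built from the circuit. -/
theorem Verifier.acceptProb_eq_maxFidelity (x : List Bool) (V : Verifier x.length)
    (ρ : QState V.proofQubits) : V.acceptProb x ρ = (V.toIsometry x).maxFidelity ρ :=
  sum_last_eq_zeroProb _ _ V.gates x (by omega) ρ.mat

/-- The verification circuit built from an isometry circuit accepts a proof with the largest
fidelity of an output with that proof. -/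
theorem IsometryCircuit.acceptProb_toVerifier (C : IsometryCircuit) (x : List Bool)
    (h : C.m₂ ≤ x.length) (σ : QState C.m₁) :
    (C.toVerifier x h).acceptProb x σ = C.maxFidelity σ := by
  have hle := C.le
  have hw : C.m₁ + C.m₂ - C.n + (x.length + C.m₁) =
      C.m₁ + (x.length + (C.m₁ + C.m₂ - C.n + 1)) - 1 := by omega
  have hx : C.m₁ + x.length ≤ C.m₁ + (x.length + (C.m₁ + C.m₂ - C.n + 1)) := by omega
  exact sum_last_eq_zeroProb_of_chain (Nat.le_add_right C.m₁ C.m₂) hle _ (by omega) hw _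
    (add_comm _ _) _ C.gates x hx σ.mat

end Overlap

end QuantumProofs

/-! ### Completeness -/

theorem mainTheorem8 (W : (k : ℕ) → Set (QuantumProofs.QState k)) (α β : ℝ) (hβα : β < α) :
    QuantumProofs.IsCompleteFor (QuantumProofs.paddedIsometryOutput W α β hβα)
      (QuantumProofs.QMA W (fun _ => α) (fun _ => β)) := by
  open QuantumProofs in
  refine ⟨⟨fun x => Program.toVerifierOut x x, ?_, ?_⟩, ?_⟩
  · exact IsPolyTime.comp_program ⟨Turing.idComputableInPolyTime id⟩ Program.toVerifier
      (c := 1000) fun x y => Program.run_toVerifier x y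
  · intro x hx
    have hC : ∃ C : IsometryCircuit, x = C.encode := by
      rcases hx with ⟨C, hC, -⟩ | ⟨C, hC, -⟩ <;> exact ⟨C, hC⟩
    obtain ⟨C, rfl⟩ := hC
    have hlen := C.add_le_length_encode
    refine ⟨C.toVerifier C.encode (by omega), toVerifierOut_encode C _ (by omega), ?_, ?_⟩
    · rintro ⟨C', hC', ρ, σ, hσ, hF⟩
      obtain rfl := IsometryCircuit.encode_injective hC'
      exact ⟨σ, hσ, (hF.trans (C.paddedFidelity_le ρ σ)).trans_eq
        (C.acceptProb_toVerifier _ _ σ).symm⟩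
    · rintro ⟨C', hC', hF⟩ σ hσ
      obtain rfl := IsometryCircuit.encode_injective hC'
      obtain ⟨ρ, hρ⟩ := C.exists_maxFidelity_le σ
      exact (C.acceptProb_toVerifier _ _ σ).trans_le (hρ.trans (hF ρ σ hσ))
  · rintro A ⟨f, hf, hA⟩
    have henc : ∀ x (V : Verifier x.length), f x = V.encode →
        Program.fromVerifierOut x (f x) = (V.toIsometry x).encode := fun x V hV => by
      rw [hV, fromVerifierOut_encode]
    refine ⟨fun x => Program.fromVerifierOut x (f x), IsPolyTime.comp_program hf
      Program.fromVerifier (c := 100) fun x y => Program.run_fromVerifier x y, fun x hx => ?_,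
      fun x hx => ?_⟩
    · obtain ⟨V, hV, hyes, -⟩ := hA x (.inl hx)
      obtain ⟨σ, hσ, hacc⟩ := hyes hx
      obtain ⟨ρ, hρ⟩ := (V.toIsometry x).exists_maxFidelity_le σ
      exact ⟨V.toIsometry x, henc x V hV, ρ, σ, hσ,
        (hacc.trans_eq (V.acceptProb_eq_maxFidelity x σ)).trans hρ⟩
    · obtain ⟨V, hV, -, hno⟩ := hA x (.inr hx)
      exact ⟨V.toIsometry x, henc x V hV, fun ρ σ hσ =>
        ((V.toIsometry x).paddedFidelity_le ρ σ).trans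
          ((V.acceptProb_eq_maxFidelity x σ).symm.trans_le (hno hx σ hσ))⟩
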